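/- Let $n\ge 2$ and let $N\subset\mathbb{R}^p$ be a compact smooth embedded submanifold without boundary, with the induced Riemannian metric. Let $\varphi:\mathbb{R}^n\to\mathbb{R}^p$ be a locally energy minimizing map into $N$: for every ball $B=B_\rho(y)$ one has $\varphi\in W^{1,2}(B;\mathbb{R}^p)$, $\varphi(x)\in N$ for a.e. $x\in B$, and $$\int_B|D\varphi|^2\le\int_B|Dw|^2$$ for every $w\in W^{1,2}(B;\mathbb{R}^p)$ with values a.e. in $N$ that agrees with $\varphi$ a.e. in a neighbourhood of $\partial B$ (within $B$). Suppose also that $\varphi$ is homogeneous of degree zero, i.e. for each $\lambda>0$, $\varphi(\lambda x)=\varphi(x)$ for a.e. $x\in\mathbb{R}^n$. Then the density $$\Theta_\varphi(y)=\lim_{\rho\downarrow 0}\rho^{2-n}\int_{B_\rho(y)}|D\varphi|^2$$ exists for every $y\in\mathbb{R}^n$, the set $S(\varphi)=\{y\in\mathbb{R}^n:\Theta_\varphi(y)=\Theta_\varphi(0)\}$ is a linear subspace of $\mathbb{R}^n$, and $\varphi(x+y)=\varphi(x)$ for $x\in\mathbb{R}^n$ and $y\in S(\varphi)$ in the following sense: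 for each $y\in S(\varphi)$ the equality holds for a.e. $x$, and $\varphi$ agrees a.e. with a map $\psi:\mathbb{R}^n\to N$ such that $\psi(\lambda x)=\psi(x)$ and $\psi(x+y)=\psi(x)$ for all $x\in\mathbb{R}^n$, $\lambda>0$ and $y\in S(\varphi)$. -/

import Mathlib

open MeasureTheory Filter Topology Set
open scoped Manifold ContDiff

noncomputable section

namespace EnergyMin

/-- The Euclidean space `ℝⁿ`. -/
abbrev E (n : ℕ) : Type := EuclideanSpace ℝ (Fin n)

/-- `G i`, for `i = 1, …, n`, are the weak partial derivatives `D_i u` on `Ω` of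
`u : Ω → ℝᵖ`, and they are all in `L²(Ω; ℝᵖ)`. The values outside `Ω` are irrelevant. -/
def IsL2WeakGradient {n p : ℕ} (Ω : Set (E n)) (u : E n → E p)
    (G : Fin n → E n → E p) : Prop :=
  (∀ i, MemLp (G i) 2 (volume.restrict Ω)) ∧
  ∀ ζ : E n → ℝ, ContDiff ℝ ∞ ζ → HasCompactSupport ζ → tsupport ζ ⊆ Ω →
    ∀ i, ∫ x in Ω, ζ x • G i x
      = - ∫ x in Ω, (fderiv ℝ ζ x (EuclideanSpace.single i 1)) • u x

/-- The Sobolev space `W^{1,2}(Ω; N)`: maps in `W^{1,2}(Ω; ℝᵖ)` with values in `N` a.e. -/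
def MemW12 {n p : ℕ} (Ω : Set (E n)) (N : Set (E p)) (u : E n → E p) : Prop :=
  MemLp u 2 (volume.restrict Ω) ∧ (∃ G, IsL2WeakGradient Ω u G) ∧
  ∀ᵐ x ∂(volume.restrict Ω), u x ∈ N

open Classical in
/-- The weak partial derivatives of `u` on `Ω` (unique up to null sets if they exist). -/
def weakGradient {n p : ℕ} (Ω : Set (E n)) (u : E n → E p) : Fin n → E n → E p :=
  if h : ∃ G, IsL2WeakGradient Ω u G then h.choose else 0

/-- The Dirichlet energy `∫_Ω |Du|²`, where `|Du|² = ∑ᵢ |D_i u|² = ∑ᵢ ∑ⱼ (D_i uʲ)²`. -/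
def energy {n p : ℕ} (Ω : Set (E n)) (u : E n → E p) : ℝ :=
  ∫ x in Ω, ∑ i, ‖weakGradient Ω u i x‖ ^ 2

/-- `u : Ω → N` is energy minimizing: on every ball `B` with closure in `Ω`, it is in
`W^{1,2}(B; N)` and has least energy among all maps in `W^{1,2}(B; N)` that agree with it
(a.e.) near the boundary of `B`. -/
def IsEnergyMinimizing {n p : ℕ} (Ω : Set (E n)) (N : Set (E p)) (u : E n → E p) : Prop :=
  ∀ (y : E n) (ρ : ℝ), 0 < ρ → Metric.closedBall y ρ ⊆ Ω →
    MemW12 (Metric.ball y ρ) N u ∧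
    ∀ w : E n → E p, MemW12 (Metric.ball y ρ) N w →
      (∃ U : Set (E n), IsOpen U ∧ Metric.sphere y ρ ⊆ U ∧
        ∀ᵐ x ∂(volume.restrict (U ∩ Metric.ball y ρ)), w x = u x) →
      energy (Metric.ball y ρ) u ≤ energy (Metric.ball y ρ) w

/-- The map `φ` on `ℝⁿ` is homogeneous of degree zero (as an a.e. class of maps). -/
def IsHomogeneousZero {n p : ℕ} (φ : E n → E p) : Prop :=
  ∀ c : ℝ, 0 < c → ∀ᵐ x, φ (c • x) = φ x

/-- The scaled energy `ρ^{2-n} ∫_{B_ρ(y)} |Du|²`. -/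
def scaledEnergy {n p : ℕ} (u : E n → E p) (y : E n) (ρ : ℝ) : ℝ :=
  ρ ^ (2 - (n : ℤ)) * energy (Metric.ball y ρ) u

/-- The density `Θ_u(y) = lim_{ρ ↓ 0} ρ^{2-n} ∫_{B_ρ(y)} |Du|²`. -/
def density {n p : ℕ} (u : E n → E p) (y : E n) : ℝ :=
  limUnder (𝓝[>] (0 : ℝ)) (scaledEnergy u y)

/-- The set `S(φ) = {y ∈ ℝⁿ : Θ_φ(y) = Θ_φ(0)}`. -/
def maxDensitySet {n p : ℕ} (φ : E n → E p) : Set (E n) :=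
  {y | density φ y = density φ 0}

end EnergyMin

end

/-! The competitors used are the maps `u ∘ Ψ⁻¹`, with `Ψ` a diffeomorphism that is the identity off
a compact subset of a ball; these automatically take values in `N`. Expanding their energy to first
order in `Ψ = id + sζ` shows that `u` is stationary (`integral_variationForm_eq_zero`). The radial
choice `ζ(x) = h(|x-y|²)(x-y)` then gives `monotonicity`: the scaled energy at `y` is nondecreasing
in the radius, and its increments control the integral of `|(x-y)·Du|²` over annuli. Being monotone
and nonnegative, the scaled energy has a limit, which is the density.

For a homogeneous `φ` the scaled energy at `0` is constant, equal to `Θ(0)`. Since `B_r(y) ⊆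
B_{r+|y|}(0)`, letting `r → ∞` and using monotonicity bounds every scaled energy at `y` by `Θ(0)`
(`scaledEnergy_le_density_zero`). If `Θ(y) = Θ(0)`, the scaled energy at `y` is therefore constant,
so `(x-y)·Dφ = 0` a.e.; likewise `x·Dφ = 0` a.e. Subtracting, `y·Dφ = 0` a.e., and `φ` is invariant
under translation by `y`. Conversely, such invariance makes the scaled energies at `y` and `0`
equal.

Thus `S(φ)` is the set of a.e. periods of `φ` (`mem_maxDensitySet_iff`). Periods form a group, and
homogeneity makes them stable under positive multiples, so `S(φ)` is a subspace. The pointwise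
statement comes from the representative defined by limits of ball averages, which inherits every
a.e. symmetry under maps `x ↦ cx + y`, `c > 0`, at every point. -/

namespace EnergyMin

/-! ### Weak gradients: uniqueness, energy, gluing -/

variable {n p : ℕ}

/-- The `i`-th vector of the standard basis of `ℝⁿ`. -/
noncomputable abbrev stdVec (i : Fin n) : E n := EuclideanSpace.single i (1 : ℝ)

lemma integrable_continuous_smul {V : Type*} [NormedAddCommGroup V] [NormedSpace ℝ V]
    {Ω : Set (E n)} {f : E n → V} (hf : LocallyIntegrableOn f Ω)
    {ζ : E n → ℝ} (hζ : Continuous ζ) (hc : HasCompactSupport ζ) (hs : tsupport ζ ⊆ Ω) :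
    Integrable (fun x => ζ x • f x) := by
  have h1 : IntegrableOn f (tsupport ζ) := hf.integrableOn_compact_subset hs hc
  have h2 : IntegrableOn (fun x => ζ x • f x) (tsupport ζ) :=
    h1.continuousOn_smul hζ.continuousOn hc
  rw [← integrableOn_iff_integrable_of_support_subset]
  · exact h2
  · intro x hx
    apply subset_tsupport
    intro h0
    exact hx (by simp [h0])

lemma IsL2WeakGradient.locallyIntegrableOn {Ω : Set (E n)} (hΩ : IsOpen Ω) {u : E n → E p}
    {G : Fin n → E n → E p} (h : IsL2WeakGradient Ω u G) (i : Fin n) :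
    LocallyIntegrableOn (G i) Ω := by
  intro x _
  obtain ⟨s, hs, hi⟩ := (h.1 i).locallyIntegrable (by norm_num) x
  refine ⟨s ∩ Ω, inter_mem (mem_nhdsWithin_of_mem_nhds hs) self_mem_nhdsWithin, ?_⟩
  rwa [IntegrableOn, Measure.restrict_restrict' hΩ.measurableSet] at hi

lemma IsL2WeakGradient.ae_eq {Ω : Set (E n)} (hΩ : IsOpen Ω) {u : E n → E p}
    {G G' : Fin n → E n → E p} (h : IsL2WeakGradient Ω u G) (h' : IsL2WeakGradient Ω u G')
    (i : Fin n) : G i =ᵐ[volume.restrict Ω] G' i := by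
  have key : ∀ᵐ x, x ∈ Ω → (G i - G' i) x = 0 := by
    refine hΩ.ae_eq_zero_of_integral_contDiff_smul_eq_zero
      ((h.locallyIntegrableOn hΩ i).sub (h'.locallyIntegrableOn hΩ i)) fun ζ hζ hc hs => ?_
    have e1 := h.2 ζ hζ hc hs i
    rw [← h'.2 ζ hζ hc hs i] at e1
    have z : ∀ H : E n → E p, ∫ x in Ω, ζ x • H x = ∫ x, ζ x • H x := fun H =>
      setIntegral_eq_integral_of_forall_compl_eq_zero fun x hx => by
        rw [image_eq_zero_of_notMem_tsupport (fun h => hx (hs h)), zero_smul]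
    rw [z, z] at e1
    simp only [Pi.sub_apply, smul_sub]
    rw [integral_sub, e1, sub_self]
    · exact integrable_continuous_smul (h.locallyIntegrableOn hΩ i) hζ.continuous hc hs
    · exact integrable_continuous_smul (h'.locallyIntegrableOn hΩ i) hζ.continuous hc hs
  rw [Filter.EventuallyEq, ae_restrict_iff' hΩ.measurableSet]
  filter_upwards [key] with x hx hxΩ
  exact sub_eq_zero.1 (hx hxΩ)

/-- `weakGradient` is an arbitrary choice; a.e. uniqueness lets the energy be computed from any
gradient at hand. -/
lemma IsL2WeakGradient.energy_eq {Ω : Set (E n)} (hΩ : IsOpen Ω) {u : E n → E p}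
    {G : Fin n → E n → E p} (h : IsL2WeakGradient Ω u G) :
    energy Ω u = ∫ x in Ω, ∑ i, ‖G i x‖ ^ 2 := by
  have hex : ∃ G, IsL2WeakGradient Ω u G := ⟨G, h⟩
  have hw : IsL2WeakGradient Ω u (weakGradient Ω u) := by
    rw [weakGradient, dif_pos hex]; exact hex.choose_spec
  refine integral_congr_ae ?_
  have := fun i => hw.ae_eq hΩ h i
  filter_upwards [eventually_all.2 this] with x hx
  simp [hx]

/-- `G` is the weak gradient of `u` on all of `ℝⁿ`, and it is locally square integrable. -/
structure IsGlobalGradient (u : E n → E p) (G : Fin n → E n → E p) : Prop where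
  memLp_fun : ∀ R : ℝ, MemLp u 2 (volume.restrict (Metric.ball 0 R))
  memLp : ∀ (i : Fin n) (R : ℝ), MemLp (G i) 2 (volume.restrict (Metric.ball 0 R))
  integral_smul : ∀ ζ : E n → ℝ, ContDiff ℝ ∞ ζ → HasCompactSupport ζ →
    ∀ i, ∫ x, ζ x • G i x = - ∫ x, (fderiv ℝ ζ x (stdVec i)) • u x

lemma memLp_ball {V : Type*} [NormedAddCommGroup V] {f : E n → V}
    (h : ∀ R : ℝ, MemLp f 2 (volume.restrict (Metric.ball 0 R))) (y : E n) (R : ℝ) :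
    MemLp f 2 (volume.restrict (Metric.ball y R)) :=
  (h (R + ‖y‖)).mono_measure (Measure.restrict_mono (Metric.ball_subset_ball' (by simp)) le_rfl)

lemma locallyIntegrable_of_memLp_ball {V : Type*} [NormedAddCommGroup V] {f : E n → V}
    (h : ∀ R : ℝ, MemLp f 2 (volume.restrict (Metric.ball 0 R))) : LocallyIntegrable f := by
  intro x
  refine ⟨Metric.ball x 1, Metric.ball_mem_nhds x one_pos, ?_⟩
  have : IsFiniteMeasure (volume.restrict (Metric.ball x 1)) :=
    ⟨by simpa using measure_ball_lt_top⟩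
  exact (memLp_ball h x 1).integrable (by norm_num)

lemma IsGlobalGradient.locallyIntegrable_fun {u : E n → E p} {G : Fin n → E n → E p}
    (h : IsGlobalGradient u G) : LocallyIntegrable u :=
  locallyIntegrable_of_memLp_ball h.memLp_fun

lemma IsGlobalGradient.locallyIntegrable {u : E n → E p} {G : Fin n → E n → E p}
    (h : IsGlobalGradient u G) (i : Fin n) : LocallyIntegrable (G i) :=
  locallyIntegrable_of_memLp_ball (h.memLp i)

lemma fderiv_apply_eq_zero_of_notMem_tsupport (ζ : E n → ℝ) (v : E n) {x : E n}
    (hx : x ∉ tsupport ζ) :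
    fderiv ℝ ζ x v = 0 := by
  have : fderiv ℝ ζ x = 0 :=
    image_eq_zero_of_notMem_tsupport fun h => hx (tsupport_fderiv_subset ℝ h)
  simp [this]

lemma IsGlobalGradient.isL2WeakGradient {u : E n → E p} {G : Fin n → E n → E p}
    (h : IsGlobalGradient u G) (y : E n) (R : ℝ) :
    IsL2WeakGradient (Metric.ball y R) u G := by
  refine ⟨fun i => memLp_ball (h.memLp i) y R, fun ζ hζ hc hs i => ?_⟩
  rw [setIntegral_eq_integral_of_forall_compl_eq_zero, h.integral_smul ζ hζ hc i,
    setIntegral_eq_integral_of_forall_compl_eq_zero]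
  · intro x hx
    rw [fderiv_apply_eq_zero_of_notMem_tsupport ζ _ fun h => hx (hs h), zero_smul]
  · intro x hx
    rw [image_eq_zero_of_notMem_tsupport fun h => hx (hs h), zero_smul]

lemma IsGlobalGradient.energy_ball {u : E n → E p} {G : Fin n → E n → E p}
    (h : IsGlobalGradient u G) (y : E n) (R : ℝ) :
    energy (Metric.ball y R) u = ∫ x in Metric.ball y R, ∑ i, ‖G i x‖ ^ 2 :=
  (h.isL2WeakGradient y R).energy_eq Metric.isOpen_ball

lemma IsGlobalGradient.ae_eq {u : E n → E p} {G G' : Fin n → E n → E p}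
    (h : IsGlobalGradient u G) (h' : IsGlobalGradient u G') (i : Fin n) : G i =ᵐ[volume] G' i := by
  refine ae_eq_of_integral_contDiff_smul_eq (h.locallyIntegrable i) (h'.locallyIntegrable i)
    fun ζ hζ hc => ?_
  rw [h.integral_smul ζ hζ hc i, h'.integral_smul ζ hζ hc i]

lemma IsGlobalGradient.congr {u u' : E n → E p} {G : Fin n → E n → E p}
    (h : IsGlobalGradient u G) (hu : u =ᵐ[volume] u') : IsGlobalGradient u' G where
  memLp_fun R := (h.memLp_fun R).ae_eq (ae_restrict_of_ae hu)
  memLp := h.memLp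
  integral_smul ζ hζ hc i := by
    rw [h.integral_smul ζ hζ hc i]
    congr 1
    refine integral_congr_ae ?_
    filter_upwards [hu] with x hx
    rw [hx]

lemma IsL2WeakGradient.mono {Ω Ω' : Set (E n)} {u : E n → E p}
    {G : Fin n → E n → E p} (h : IsL2WeakGradient Ω u G) (hs : Ω' ⊆ Ω) :
    IsL2WeakGradient Ω' u G := by
  refine ⟨fun i => (h.1 i).mono_measure (Measure.restrict_mono hs le_rfl),
    fun ζ hζ hc hs' i => ?_⟩
  have := h.2 ζ hζ hc (hs'.trans hs) i
  have z : ∀ O : Set (E n), tsupport ζ ⊆ O → ∀ H : E n → E p,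
      ∫ x in O, ζ x • H x = ∫ x, ζ x • H x := fun O hO H =>
    setIntegral_eq_integral_of_forall_compl_eq_zero fun x hx => by
      rw [image_eq_zero_of_notMem_tsupport (fun h => hx (hO h)), zero_smul]
  have z' : ∀ O : Set (E n), tsupport ζ ⊆ O → ∀ H : E n → E p,
      ∫ x in O, (fderiv ℝ ζ x (stdVec i)) • H x = ∫ x, (fderiv ℝ ζ x (stdVec i)) • H x :=
    fun O hO H => setIntegral_eq_integral_of_forall_compl_eq_zero fun x hx => by
      rw [fderiv_apply_eq_zero_of_notMem_tsupport ζ _ fun h => hx (hO h), zero_smul]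
  rw [z _ (hs'.trans hs), z' _ (hs'.trans hs)] at this
  rw [z _ hs', z' _ hs', this]

/-- Weak gradients on all balls centred at the origin glue to a global one. -/
lemma exists_isGlobalGradient {u : E n → E p}
    (h : ∀ R : ℝ, 0 < R → MemLp u 2 (volume.restrict (Metric.ball 0 R)) ∧
      ∃ G, IsL2WeakGradient (Metric.ball 0 R) u G) :
    ∃ G, IsGlobalGradient u G := by
  have hpos : ∀ k : ℕ, (0 : ℝ) < k + 1 := fun k => by positivity
  choose H hH using fun k : ℕ => (h (k + 1) (hpos k)).2
  -- `H k` lives on the ball of radius `k + 1`, so `⌊‖x‖⌋₊` is the least index whose ball contains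
  -- `x`.
  let G : Fin n → E n → E p := fun i x => H ⌊‖x‖⌋₊ i x
  have hG : ∀ (k : ℕ) (i : Fin n), H k i =ᵐ[volume.restrict (Metric.ball 0 ((k : ℝ) + 1))] G i := by
    intro k i
    have hall : ∀ m : ℕ, ∀ᵐ x, m ≤ k → x ∈ Metric.ball (0 : E n) ((m : ℝ) + 1) →
        H k i x = H m i x := by
      intro m
      by_cases hm : m ≤ k
      · have := ((hH k).mono (Metric.ball_subset_ball (x := (0 : E n)) (ε₁ := (m : ℝ) + 1)
          (by gcongr))).ae_eq Metric.isOpen_ball (hH m) i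
        rw [Filter.EventuallyEq, ae_restrict_iff' Metric.isOpen_ball.measurableSet] at this
        filter_upwards [this] with x hx _ using hx
      · exact Eventually.of_forall fun x hx => absurd hx hm
    rw [Filter.EventuallyEq, ae_restrict_iff' Metric.isOpen_ball.measurableSet]
    filter_upwards [ae_all_iff.2 hall] with x hx hxk
    refine hx _ ?_ ?_
    · rw [mem_ball_zero_iff] at hxk
      exact Nat.lt_succ_iff.1 ((Nat.floor_lt (norm_nonneg x)).2 (by push_cast; exact hxk))
    · rw [mem_ball_zero_iff]
      exact Nat.lt_floor_add_one _
  have hball : ∀ R : ℝ, Metric.ball (0 : E n) R ⊆ Metric.ball 0 ((⌈R⌉₊ : ℝ) + 1) := fun R =>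
    Metric.ball_subset_ball ((Nat.le_ceil R).trans (by linarith))
  have hL : ∀ (k : ℕ), IsL2WeakGradient (Metric.ball 0 ((k : ℝ) + 1)) u G := by
    intro k
    refine ⟨fun i => ((hH k).1 i).ae_eq (hG k i), fun ζ hζ hc hs i => ?_⟩
    rw [← (hH k).2 ζ hζ hc hs i]
    refine integral_congr_ae ?_
    filter_upwards [hG k i] with x hx
    rw [hx]
  refine ⟨G, ⟨fun R => ?_, fun i R => ?_, fun ζ hζ hc i => ?_⟩⟩
  · exact ((h _ (hpos ⌈R⌉₊)).1).mono_measure (Measure.restrict_mono (hball R) le_rfl)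
  · exact ((hL ⌈R⌉₊).1 i).mono_measure (Measure.restrict_mono (hball R) le_rfl)
  · obtain ⟨R, hR⟩ := hc.isCompact.isBounded.subset_ball (0 : E n)
    have hs := hR.trans (hball R)
    have := (hL ⌈R⌉₊).2 ζ hζ hc hs i
    rw [setIntegral_eq_integral_of_forall_compl_eq_zero,
      setIntegral_eq_integral_of_forall_compl_eq_zero] at this
    · exact this
    · intro x hx
      rw [fderiv_apply_eq_zero_of_notMem_tsupport ζ _ fun h => hx (hs h), zero_smul]
    · intro x hx
      rw [image_eq_zero_of_notMem_tsupport fun h => hx (hs h), zero_smul]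

/-! ### Diffeomorphisms and change of variables -/

lemma det_eq_sum (A : E n →L[ℝ] E n) :
    A.det = ∑ σ : Equiv.Perm (Fin n), Equiv.Perm.sign σ • ∏ i, A (stdVec i) (σ i) := by
  have h := LinearMap.det_toMatrix (EuclideanSpace.basisFun (Fin n) ℝ).toBasis
    (A : E n →ₗ[ℝ] E n)
  rw [ContinuousLinearMap.det, ← h, Matrix.det_apply]
  simp [LinearMap.toMatrix_apply]

/-- By the Leibniz formula the determinant is a polynomial in the entries, which are continuous
linear functionals. -/
lemma contDiff_det : ContDiff ℝ ∞ (fun A : E n →L[ℝ] E n => A.det) := by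
  simp only [det_eq_sum, Units.smul_def, zsmul_eq_mul]
  refine ContDiff.sum fun σ _ => contDiff_const.mul (contDiff_prod fun i _ => ?_)
  have : (fun A : E n →L[ℝ] E n => A (stdVec i) (σ i)) =
      ((EuclideanSpace.proj (σ i) : E n →L[ℝ] ℝ).comp
        (ContinuousLinearMap.apply ℝ (E n) (stdVec i)) : (E n →L[ℝ] E n) →L[ℝ] ℝ) := by
    ext A; simp
  rw [this]
  exact ContinuousLinearMap.contDiff _

/-- `Ψ` is an orientation-preserving smooth diffeomorphism of `ℝⁿ` with inverse `Θ`. -/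
structure IsDiffeo (Ψ Θ : E n → E n) : Prop where
  contDiff : ContDiff ℝ ∞ Ψ
  contDiff_inv : ContDiff ℝ ∞ Θ
  left_inv : ∀ x, Θ (Ψ x) = x
  right_inv : ∀ z, Ψ (Θ z) = z
  det_pos : ∀ x, 0 < (fderiv ℝ Ψ x).det

namespace IsDiffeo

variable {Ψ Θ : E n → E n}

lemma hasFDerivAt (h : IsDiffeo Ψ Θ) (x : E n) : HasFDerivAt Ψ (fderiv ℝ Ψ x) x :=
  (h.contDiff.differentiable (by simp) x).hasFDerivAt

lemma image_univ (h : IsDiffeo Ψ Θ) : Ψ '' univ = univ := by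
  ext z; simpa using ⟨Θ z, h.right_inv z⟩

lemma injective (h : IsDiffeo Ψ Θ) : Function.Injective Ψ := fun x y hxy => by
  rw [← h.left_inv x, hxy, h.left_inv]

lemma setIntegral_image {V : Type*} [NormedAddCommGroup V] [NormedSpace ℝ V]
    (h : IsDiffeo Ψ Θ) {s : Set (E n)} (hs : MeasurableSet s) (F : E n → V) :
    ∫ z in Ψ '' s, F z = ∫ x in s, (fderiv ℝ Ψ x).det • F (Ψ x) := by
  rw [integral_image_eq_integral_abs_det_fderiv_smul volume hs
    (fun x _ => (h.hasFDerivAt x).hasFDerivWithinAt) h.injective.injOn]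
  simp only [abs_of_pos (h.det_pos _)]

lemma integral_comp {V : Type*} [NormedAddCommGroup V] [NormedSpace ℝ V]
    (h : IsDiffeo Ψ Θ) (F : E n → V) :
    ∫ z, F z = ∫ x, (fderiv ℝ Ψ x).det • F (Ψ x) := by
  have := h.setIntegral_image MeasurableSet.univ F
  rwa [h.image_univ, Measure.restrict_univ] at this

lemma integrableOn_image {V : Type*} [NormedAddCommGroup V] [NormedSpace ℝ V]
    (h : IsDiffeo Ψ Θ) {s : Set (E n)} (hs : MeasurableSet s) (F : E n → V) :
    IntegrableOn F (Ψ '' s) ↔ IntegrableOn (fun x => (fderiv ℝ Ψ x).det • F (Ψ x)) s := by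
  rw [integrableOn_image_iff_integrableOn_abs_det_fderiv_smul volume hs
    (fun x _ => (h.hasFDerivAt x).hasFDerivWithinAt) h.injective.injOn]
  simp only [abs_of_pos (h.det_pos _)]

lemma quasiMeasurePreserving_inv (h : IsDiffeo Ψ Θ) :
    Measure.QuasiMeasurePreserving Θ volume volume := by
  refine ⟨h.contDiff_inv.continuous.measurable, ?_⟩
  refine Measure.AbsolutelyContinuous.mk fun s hs h0 => ?_
  rw [Measure.map_apply h.contDiff_inv.continuous.measurable hs]
  have : Θ ⁻¹' s = Ψ '' s := by
    ext z
    constructor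
    · intro hz; exact ⟨Θ z, hz, h.right_inv z⟩
    · rintro ⟨x, hx, rfl⟩; simpa [h.left_inv] using hx
  rw [this]
  exact addHaar_image_eq_zero_of_differentiableOn_of_addHaar_eq_zero volume
    (h.contDiff.differentiable (by simp)).differentiableOn h0

lemma fderiv_inv_apply (h : IsDiffeo Ψ Θ) (x : E n) (v : E n) :
    fderiv ℝ Ψ x (fderiv ℝ Θ (Ψ x) v) = v := by
  have e : Ψ ∘ Θ = id := funext h.right_inv
  have h1 : HasFDerivAt Ψ (fderiv ℝ Ψ x) (Θ (Ψ x)) := by rw [h.left_inv]; exact h.hasFDerivAt x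
  have h2 := h1.comp (Ψ x) (h.contDiff_inv.differentiable (by simp) (Ψ x)).hasFDerivAt
  rw [e] at h2
  have := h2.unique (hasFDerivAt_id _)
  exact congrArg (fun L : E n →L[ℝ] E n => L v) this

lemma contDiff_det_fderiv (h : IsDiffeo Ψ Θ) : ContDiff ℝ ∞ (fun x => (fderiv ℝ Ψ x).det) :=
  contDiff_det.comp (h.contDiff.fderiv_right (by simp))

end IsDiffeo

/-! ### The Piola identity and the chain rule for Sobolev maps -/

lemma integral_mul_fderiv_of_hasCompactSupport {f g : E n → ℝ} (hf : ContDiff ℝ ∞ f)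
    (hg : ContDiff ℝ ∞ g) (hc : HasCompactSupport f) (v : E n) :
    ∫ x, f x * fderiv ℝ g x v = - ∫ x, fderiv ℝ f x v * g x := by
  have cf : Continuous (fun x => fderiv ℝ f x v) :=
    (hf.continuous_fderiv (by simp)).clm_apply continuous_const
  have cg : Continuous (fun x => fderiv ℝ g x v) :=
    (hg.continuous_fderiv (by simp)).clm_apply continuous_const
  refine integral_mul_fderiv_eq_neg_fderiv_mul_of_integrable ?_ ?_ ?_
    (fun x _ => hf.differentiable (by simp) x) (fun x _ => hg.differentiable (by simp) x)
  · refine (cf.mul hg.continuous).integrable_of_hasCompactSupport ?_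
    exact (hc.fderiv_apply ℝ v).mul_right
  · exact (hf.continuous.mul cg).integrable_of_hasCompactSupport hc.mul_right
  · exact (hf.continuous.mul hg.continuous).integrable_of_hasCompactSupport hc.mul_right

lemma eq_sum_stdVec (v : E n) : v = ∑ j, v j • stdVec j := by
  have := (EuclideanSpace.basisFun (Fin n) ℝ).sum_repr v
  simpa using this.symm

/-- The components of `det(DΨ) ζ∘Ψ (DΨ)⁻¹ eᵢ`. -/
noncomputable def piolaField (Ψ Θ : E n → E n) (ζ : E n → ℝ) (i j : Fin n) (x : E n) : ℝ :=
  (fderiv ℝ Ψ x).det * ζ (Ψ x) * fderiv ℝ Θ (Ψ x) (stdVec i) j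

namespace IsDiffeo

variable {Ψ Θ : E n → E n}

lemma contDiff_piolaField (h : IsDiffeo Ψ Θ) {ζ : E n → ℝ} (hζ : ContDiff ℝ ∞ ζ) (i j : Fin n) :
    ContDiff ℝ ∞ (piolaField Ψ Θ ζ i j) := by
  unfold piolaField
  refine (h.contDiff_det_fderiv.mul (hζ.comp h.contDiff)).mul ?_
  have h1 : ContDiff ℝ ∞ (fun x => fderiv ℝ Θ (Ψ x) (stdVec i)) :=
    ((h.contDiff_inv.fderiv_right (m := ∞) (by simp)).comp h.contDiff).clm_apply contDiff_const
  exact (contDiff_euclidean.1 h1) j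

lemma hasCompactSupport_comp (h : IsDiffeo Ψ Θ) {ζ : E n → ℝ} (hc : HasCompactSupport ζ) :
    HasCompactSupport (fun x => ζ (Ψ x)) := by
  let e : E n ≃ₜ E n := ⟨⟨Ψ, Θ, h.left_inv, h.right_inv⟩, h.contDiff.continuous,
    h.contDiff_inv.continuous⟩
  exact hc.comp_homeomorph e

lemma hasCompactSupport_piolaField (h : IsDiffeo Ψ Θ) {ζ : E n → ℝ} (hc : HasCompactSupport ζ)
    (i j : Fin n) : HasCompactSupport (piolaField Ψ Θ ζ i j) := by
  unfold piolaField
  exact (HasCompactSupport.mul_left (h.hasCompactSupport_comp hc)).mul_right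

/-- The Piola identity, tested against smooth functions. -/
lemma sum_fderiv_piolaField (h : IsDiffeo Ψ Θ) {ζ : E n → ℝ} (hζ : ContDiff ℝ ∞ ζ)
    (hc : HasCompactSupport ζ) (i : Fin n) :
    (fun x => ∑ j, fderiv ℝ (piolaField Ψ Θ ζ i j) x (stdVec j)) =ᵐ[volume]
      fun x => (fderiv ℝ Ψ x).det * fderiv ℝ ζ (Ψ x) (stdVec i) := by
  have hX := fun j => h.contDiff_piolaField hζ i j
  have hXc := fun j => h.hasCompactSupport_piolaField hc i j
  have c1 : Continuous fun x => ∑ j, fderiv ℝ (piolaField Ψ Θ ζ i j) x (stdVec j) :=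
    continuous_finsetSum _ fun j _ =>
      ((hX j).continuous_fderiv (by simp)).clm_apply continuous_const
  have c2 : Continuous fun x => (fderiv ℝ Ψ x).det * fderiv ℝ ζ (Ψ x) (stdVec i) :=
    h.contDiff_det_fderiv.continuous.mul
      (((hζ.continuous_fderiv (by simp)).comp h.contDiff.continuous).clm_apply continuous_const)
  refine ae_eq_of_integral_contDiff_smul_eq c1.locallyIntegrable c2.locallyIntegrable
    fun g hg hgc => ?_
  have cd : ∀ j, Continuous fun x => fderiv ℝ (piolaField Ψ Θ ζ i j) x (stdVec j) := fun j =>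
    ((hX j).continuous_fderiv (by simp)).clm_apply continuous_const
  have cgd : ∀ j, Continuous fun x => fderiv ℝ g x (stdVec j) := fun j =>
    (hg.continuous_fderiv (by simp)).clm_apply continuous_const
  -- Integrating by parts in `x`, substituting `z = Ψ x`, and integrating by parts in `z` avoids
  -- differentiating the determinant explicitly. The middle step recognizes `∂ᵢ(g ∘ Θ)` at `Ψ x`.
  calc ∫ x, g x • ∑ j, fderiv ℝ (piolaField Ψ Θ ζ i j) x (stdVec j)
      = ∑ j, ∫ x, fderiv ℝ (piolaField Ψ Θ ζ i j) x (stdVec j) * g x := by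
        rw [← integral_finsetSum]
        · simp only [smul_eq_mul, Finset.mul_sum, mul_comm]
        · intro j _
          exact ((cd j).mul hg.continuous).integrable_of_hasCompactSupport hgc.mul_left
    _ = - ∑ j, ∫ x, piolaField Ψ Θ ζ i j x * fderiv ℝ g x (stdVec j) := by
        rw [← Finset.sum_neg_distrib]
        refine Finset.sum_congr rfl fun j _ => ?_
        rw [integral_mul_fderiv_of_hasCompactSupport (hX j) hg (hXc j), neg_neg]
    _ = - ∫ x, (fderiv ℝ Ψ x).det • (ζ (Ψ x) * fderiv ℝ (g ∘ Θ) (Ψ x) (stdVec i)) := by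
        rw [← integral_finsetSum]
        · congr 2
          ext x
          have : fderiv ℝ (g ∘ Θ) (Ψ x) (stdVec i) =
              ∑ j, fderiv ℝ Θ (Ψ x) (stdVec i) j * fderiv ℝ g x (stdVec j) := by
            rw [fderiv_comp _ (hg.differentiable (by simp) _)
              (h.contDiff_inv.differentiable (by simp) _), h.left_inv]
            simp only [ContinuousLinearMap.comp_apply]
            conv_lhs => rw [eq_sum_stdVec (fderiv ℝ Θ (Ψ x) (stdVec i))]
            simp
          rw [this, smul_eq_mul, Finset.mul_sum, Finset.mul_sum]
          refine Finset.sum_congr rfl fun j _ => ?_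
          unfold piolaField; ring
        · intro j _
          exact ((hX j).continuous.mul (cgd j)).integrable_of_hasCompactSupport (hXc j).mul_right
    _ = - ∫ z, ζ z * fderiv ℝ (g ∘ Θ) z (stdVec i) := by
        rw [h.integral_comp (fun z => ζ z * fderiv ℝ (g ∘ Θ) z (stdVec i))]
    _ = ∫ z, fderiv ℝ ζ z (stdVec i) * (g ∘ Θ) z := by
        rw [integral_mul_fderiv_of_hasCompactSupport hζ (hg.comp h.contDiff_inv) hc, neg_neg]
    _ = ∫ x, g x • ((fderiv ℝ Ψ x).det * fderiv ℝ ζ (Ψ x) (stdVec i)) := by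
        rw [h.integral_comp]
        congr 1
        ext x
        simp only [Function.comp_apply, h.left_inv, smul_eq_mul]
        ring

end IsDiffeo

/-- The weak gradient of `u ∘ Θ`, where `G` is that of `u`. -/
noncomputable def compGradient (Θ : E n → E n) (G : Fin n → E n → E p) (i : Fin n) (z : E n) :
    E p :=
  ∑ j, fderiv ℝ Θ z (stdVec i) j • G j (Θ z)

lemma IsGlobalGradient.integrable_smul {u : E n → E p} {G : Fin n → E n → E p}
    (hG : IsGlobalGradient u G) {ζ : E n → ℝ} (hζ : Continuous ζ) (hc : HasCompactSupport ζ)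
    (i : Fin n) : Integrable (fun x => ζ x • G i x) :=
  integrable_continuous_smul ((hG.locallyIntegrable i).locallyIntegrableOn univ) hζ hc
    (subset_univ _)

lemma IsGlobalGradient.integrable_smul_fun {u : E n → E p} {G : Fin n → E n → E p}
    (hG : IsGlobalGradient u G) {ζ : E n → ℝ} (hζ : Continuous ζ) (hc : HasCompactSupport ζ) :
    Integrable (fun x => ζ x • u x) :=
  integrable_continuous_smul (hG.locallyIntegrable_fun.locallyIntegrableOn univ) hζ hc
    (subset_univ _)

/-- After the substitution `z = Ψ x`, the gradient of `u` is tested against the Piola field, which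
is smooth with compact support; the Piola identity evaluates its divergence. -/
lemma IsGlobalGradient.integral_comp_diffeo {u : E n → E p} {G : Fin n → E n → E p}
    (hG : IsGlobalGradient u G) {Ψ Θ : E n → E n} (h : IsDiffeo Ψ Θ) {ζ : E n → ℝ}
    (hζ : ContDiff ℝ ∞ ζ) (hc : HasCompactSupport ζ) (i : Fin n) :
    ∫ z, ζ z • compGradient Θ G i z = - ∫ z, (fderiv ℝ ζ z (stdVec i)) • u (Θ z) := by
  have hX := fun j => h.contDiff_piolaField hζ i j
  have hXc := fun j => h.hasCompactSupport_piolaField hc i j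
  have cd : ∀ j, Continuous fun x => fderiv ℝ (piolaField Ψ Θ ζ i j) x (stdVec j) := fun j =>
    ((hX j).continuous_fderiv (by simp)).clm_apply continuous_const
  calc ∫ z, ζ z • compGradient Θ G i z
      = ∫ x, ∑ j, piolaField Ψ Θ ζ i j x • G j x := by
        rw [h.integral_comp]
        congr 1
        ext1 x
        simp only [compGradient, h.left_inv, Finset.smul_sum]
        refine Finset.sum_congr rfl fun j _ => ?_
        simp only [smul_smul, piolaField, mul_assoc]
    _ = ∑ j, - ∫ x, fderiv ℝ (piolaField Ψ Θ ζ i j) x (stdVec j) • u x := by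
        rw [integral_finsetSum]
        · exact Finset.sum_congr rfl fun j _ => hG.integral_smul _ (hX j) (hXc j) j
        · exact fun j _ => hG.integrable_smul (hX j).continuous (hXc j) j
    _ = - ∫ x, (∑ j, fderiv ℝ (piolaField Ψ Θ ζ i j) x (stdVec j)) • u x := by
        rw [Finset.sum_neg_distrib, ← integral_finsetSum]
        · simp only [Finset.sum_smul]
        · exact fun j _ => hG.integrable_smul_fun (cd j) ((hXc j).fderiv_apply ℝ _)
    _ = - ∫ x, ((fderiv ℝ Ψ x).det * fderiv ℝ ζ (Ψ x) (stdVec i)) • u x := by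
        congr 1
        refine integral_congr_ae ?_
        filter_upwards [h.sum_fderiv_piolaField hζ hc i] with x hx
        rw [hx]
    _ = - ∫ z, (fderiv ℝ ζ z (stdVec i)) • u (Θ z) := by
        rw [h.integral_comp (fun z => (fderiv ℝ ζ z (stdVec i)) • u (Θ z))]
        simp only [h.left_inv, smul_smul]

lemma IsDiffeo.memLp_comp_inv {Ψ Θ : E n → E n} (h : IsDiffeo Ψ Θ) {V : Type*}
    [NormedAddCommGroup V] {f : E n → V}
    (hf : ∀ R : ℝ, MemLp f 2 (volume.restrict (Metric.ball 0 R))) (R : ℝ) :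
    MemLp (fun z => f (Θ z)) 2 (volume.restrict (Metric.ball 0 R)) := by
  have hfm : AEStronglyMeasurable f volume :=
    (locallyIntegrable_of_memLp_ball hf).aestronglyMeasurable
  have hm : AEStronglyMeasurable (fun z => f (Θ z)) volume :=
    hfm.comp_quasiMeasurePreserving h.quasiMeasurePreserving_inv
  refine (memLp_two_iff_integrable_sq_norm hm.restrict).2 ?_
  -- On this compact set the Jacobian is bounded, and `f` is square integrable on a ball that
  -- contains it.
  have hK : IsCompact (Θ '' Metric.closedBall 0 R) :=
    (isCompact_closedBall 0 R).image h.contDiff_inv.continuous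
  have hsub : Metric.ball (0 : E n) R ⊆ Ψ '' (Θ '' Metric.closedBall 0 R) := fun z hz =>
    ⟨Θ z, ⟨z, Metric.ball_subset_closedBall hz, rfl⟩, h.right_inv z⟩
  have : IntegrableOn (fun z => ‖f (Θ z)‖ ^ 2) (Ψ '' (Θ '' Metric.closedBall 0 R)) := by
    rw [h.integrableOn_image hK.measurableSet]
    simp only [h.left_inv, smul_eq_mul]
    obtain ⟨r, hr⟩ := hK.isBounded.subset_ball (0 : E n)
    have h2 : IntegrableOn (fun x => ‖f x‖ ^ 2) (Θ '' Metric.closedBall 0 R) :=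
      (IntegrableOn.mono_set ((memLp_two_iff_integrable_sq_norm hfm.restrict).1 (hf r)) hr)
    exact h2.continuousOn_mul h.contDiff_det_fderiv.continuous.continuousOn hK
  exact this.mono_set hsub

/-- The chain rule for the composition of a Sobolev map with a diffeomorphism. -/
lemma IsGlobalGradient.comp_diffeo {u : E n → E p} {G : Fin n → E n → E p}
    (hG : IsGlobalGradient u G) {Ψ Θ : E n → E n} (h : IsDiffeo Ψ Θ) :
    IsGlobalGradient (fun z => u (Θ z)) (compGradient Θ G) where
  memLp_fun := h.memLp_comp_inv hG.memLp_fun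
  memLp i R := by
    unfold compGradient
    refine memLp_finsetSum _ fun j _ => ?_
    have hc : Continuous fun z => fderiv ℝ Θ z (stdVec i) j :=
      (EuclideanSpace.proj (𝕜 := ℝ) j).continuous.comp
        ((h.contDiff_inv.continuous_fderiv (by simp)).clm_apply continuous_const)
    obtain ⟨C, hC⟩ := (isCompact_closedBall (0 : E n) R).exists_bound_of_continuousOn
      hc.continuousOn
    refine MemLp.of_le_mul (c := C) (h.memLp_comp_inv (hG.memLp j) R)
      (hc.aestronglyMeasurable.smul (h.memLp_comp_inv (hG.memLp j) R).1) ?_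
    refine (ae_restrict_iff' Metric.isOpen_ball.measurableSet).2 (Eventually.of_forall ?_)
    intro z hz
    rw [norm_smul]
    exact mul_le_mul_of_nonneg_right (hC z (Metric.ball_subset_closedBall hz)) (norm_nonneg _)
  integral_smul ζ hζ hc i := hG.integral_comp_diffeo h hζ hc i

/-! ### First-order expansion of the Dirichlet integrand -/

/-- The trace of an endomorphism of `ℝⁿ`, as a continuous linear functional. -/
noncomputable def traceCLM (n : ℕ) : (E n →L[ℝ] E n) →L[ℝ] ℝ :=
  ∑ i, (EuclideanSpace.proj i : E n →L[ℝ] ℝ).comp (ContinuousLinearMap.apply ℝ (E n) (stdVec i))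

lemma traceCLM_apply (A : E n →L[ℝ] E n) : traceCLM n A = ∑ i, A (stdVec i) i := by
  simp [traceCLM]

/-- The matrix entry `A ↦ A_{ji}`, as a continuous linear functional. -/
noncomputable def entryCLM (j i : Fin n) : (E n →L[ℝ] E n) →L[ℝ] ℝ :=
  (EuclideanSpace.proj j : E n →L[ℝ] ℝ).comp (ContinuousLinearMap.apply ℝ (E n) (stdVec i))

lemma entryCLM_apply (A : E n →L[ℝ] E n) (j i : Fin n) : entryCLM j i A = A (stdVec i) j := by
  simp [entryCLM]

lemma hasDerivAt_det_one_add_smul (A : E n →L[ℝ] E n) :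
    HasDerivAt (fun s : ℝ => (1 + s • A).det) (traceCLM n A) 0 := by
  let b := (EuclideanSpace.basisFun (Fin n) ℝ).toBasis
  let M : Matrix (Fin n) (Fin n) ℝ := LinearMap.toMatrix b b (A : E n →ₗ[ℝ] E n)
  have h1 : ∀ s : ℝ, (1 + s • A).det = Matrix.det (1 + s • M) := by
    intro s
    rw [ContinuousLinearMap.det, ← LinearMap.det_toMatrix b]
    congr 1
    have : ((1 + s • A : E n →L[ℝ] E n) : E n →ₗ[ℝ] E n) =
      LinearMap.id + s • (A : E n →ₗ[ℝ] E n) := rfl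
    rw [this, map_add, LinearMap.toMatrix_id, map_smul]
  have h2 : M.trace = traceCLM n A := by
    rw [traceCLM_apply]
    simp [M, b, Matrix.trace, LinearMap.toMatrix_apply]
  -- The terms of degree at least two, divided by `X²`; they contribute nothing to the derivative at
  -- `0`.
  let P := (Matrix.det (1 + (Polynomial.X : Polynomial ℝ) • M.map Polynomial.C)).divX.divX
  have h0 : (fun s : ℝ => (1 + s • A).det) =
      fun s => 1 + traceCLM n A * s + P.eval s * s ^ 2 :=
    funext fun s => by rw [h1, Matrix.det_one_add_smul, h2]
  rw [h0]
  have h3 := (((hasDerivAt_id (0 : ℝ)).const_mul (traceCLM n A)).const_add 1).add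
    ((P.hasDerivAt 0).mul ((hasDerivAt_id (0 : ℝ)).pow 2))
  convert! h3 using 1
  simp

/-- Differentiability is known from smoothness, so the derivative can be read off along the lines `s
↦ s • A`. -/
lemma hasFDerivAt_det_one_add :
    HasFDerivAt (fun B : E n →L[ℝ] E n => (1 + B).det) (traceCLM n) 0 := by
  have hd : DifferentiableAt ℝ (fun B : E n →L[ℝ] E n => (1 + B).det) 0 :=
    ((contDiff_det.comp (contDiff_const.add contDiff_id)).differentiable (by simp)) 0
  convert! hd.hasFDerivAt using 1
  ext A
  have h1 : HasDerivAt (fun s : ℝ => s • A) A 0 := by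
    simpa using (hasDerivAt_id (0 : ℝ)).smul_const A
  have h2 := HasFDerivAt.comp_hasDerivAt_of_eq (x := (0 : ℝ)) (f := fun s : ℝ => s • A)
    hd.hasFDerivAt h1 (zero_smul ℝ A).symm
  exact (hasDerivAt_det_one_add_smul A).unique h2

lemma hasFDerivAt_inverse_one_add :
    HasFDerivAt (fun B : E n →L[ℝ] E n => Ring.inverse (1 + B))
      (-ContinuousLinearMap.id ℝ (E n →L[ℝ] E n)) 0 := by
  have h := hasFDerivAt_ringInverse (𝕜 := ℝ) (1 : (E n →L[ℝ] E n)ˣ)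
  have h1 : HasFDerivAt (fun B : E n →L[ℝ] E n => 1 + B)
      (ContinuousLinearMap.id ℝ (E n →L[ℝ] E n)) 0 := (hasFDerivAt_id _).const_add 1
  have h0 : ((1 : (E n →L[ℝ] E n)ˣ) : E n →L[ℝ] E n) = 1 + 0 := by simp
  rw [h0] at h
  have h2 := HasFDerivAt.comp (0 : E n →L[ℝ] E n) h h1
  convert! h2 using 1

/-- The coefficients of the transformed Dirichlet integrand. -/
noncomputable def energyCoeff (j k : Fin n) (B : E n →L[ℝ] E n) : ℝ :=
  (1 + B).det * ∑ i, entryCLM j i (Ring.inverse (1 + B)) * entryCLM k i (Ring.inverse (1 + B))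

lemma stdVec_apply (i j : Fin n) : (stdVec i : E n) j = if j = i then 1 else 0 := by
  simp [stdVec]

lemma energyCoeff_zero (j k : Fin n) :
    energyCoeff j k (0 : E n →L[ℝ] E n) = if j = k then 1 else 0 := by
  have h1 : (1 : E n →L[ℝ] E n).det = 1 := by simp [ContinuousLinearMap.det]
  simp only [energyCoeff, add_zero, h1, Ring.inverse_one, entryCLM_apply,
    one_apply_eq_self, stdVec_apply, one_mul]
  simp

/-- Product rule at the identity: the determinant contributes the trace, and each of the two inverse
factors contributes minus an entry. -/
lemma hasFDerivAt_energyCoeff (j k : Fin n) :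
    HasFDerivAt (energyCoeff j k : (E n →L[ℝ] E n) → ℝ)
      ((if j = k then (1 : ℝ) else 0) • traceCLM n - entryCLM j k - entryCLM k j) 0 := by
  have hi := fun l i : Fin n => (entryCLM l i).hasFDerivAt.comp (0 : E n →L[ℝ] E n)
    hasFDerivAt_inverse_one_add
  have hs := HasFDerivAt.fun_sum (u := Finset.univ) fun i _ => (hi j i).mul (hi k i)
  have h := hasFDerivAt_det_one_add.mul hs
  convert! h using 1
  have h1 : (1 : E n →L[ℝ] E n).det = 1 := by simp [ContinuousLinearMap.det]
  ext B
  simp only [add_zero, h1, Function.comp_apply, Ring.inverse_one, entryCLM_apply,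
    one_apply_eq_self, stdVec_apply, Pi.mul_apply,
    _root_.add_apply, _root_.sub_apply, _root_.smul_apply,
    _root_.sum_apply, ContinuousLinearMap.comp_apply, _root_.neg_apply,
    ContinuousLinearMap.id_apply, smul_eq_mul, one_mul, PiLp.neg_apply]
  simp [Finset.sum_add_distrib, eq_comm]
  ring

lemma sq_norm_sum_smul (c : Fin n → ℝ) (g : Fin n → E p) :
    ‖∑ j, c j • g j‖ ^ 2 = ∑ j, ∑ k, c j * c k * inner ℝ (g j) (g k) := by
  rw [← real_inner_self_eq_norm_sq, sum_inner]
  refine Finset.sum_congr rfl fun j _ => ?_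
  rw [inner_sum]
  refine Finset.sum_congr rfl fun k _ => ?_
  rw [real_inner_smul_left, real_inner_smul_right]; ring

/-- The coefficients of this quadratic form in `g` depend on `B` alone, so expanding them gives
estimates uniform in `g`. -/
lemma det_mul_sum_sq_norm (B : E n →L[ℝ] E n) (g : Fin n → E p) :
    (1 + B).det * ∑ i, ‖∑ j, Ring.inverse (1 + B) (stdVec i) j • g j‖ ^ 2 =
      ∑ j, ∑ k, energyCoeff j k B * inner ℝ (g j) (g k) := by
  simp only [sq_norm_sum_smul, energyCoeff, entryCLM_apply]
  rw [Finset.sum_comm, Finset.mul_sum]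
  refine Finset.sum_congr rfl fun j _ => ?_
  rw [Finset.sum_comm, Finset.mul_sum]
  refine Finset.sum_congr rfl fun k _ => ?_
  rw [← Finset.sum_mul]; ring

/-- The first variation of the Dirichlet integrand in the direction `B`. -/
noncomputable def variationForm (B : E n →L[ℝ] E n) (g : Fin n → E p) : ℝ :=
  traceCLM n B * ∑ i, ‖g i‖ ^ 2 - 2 * ∑ i, ∑ j, B (stdVec i) j * inner ℝ (g i) (g j)

lemma variationForm_smul (s : ℝ) (B : E n →L[ℝ] E n) (g : Fin n → E p) :
    variationForm (s • B) g = s * variationForm B g := by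
  simp only [variationForm, map_smul, smul_eq_mul, _root_.smul_apply,
    PiLp.smul_apply, mul_sub, Finset.mul_sum, mul_assoc]
  congr 1
  refine Finset.sum_congr rfl fun i _ => Finset.sum_congr rfl fun j _ => ?_
  ring

lemma sum_deriv_energyCoeff (B : E n →L[ℝ] E n) (g : Fin n → E p) :
    ∑ j, ∑ k, ((if j = k then (1 : ℝ) else 0) • traceCLM n - entryCLM j k - entryCLM k j) B *
      inner ℝ (g j) (g k) = variationForm B g := by
  simp only [_root_.sub_apply, _root_.smul_apply, entryCLM_apply,
    sub_mul, Finset.sum_sub_distrib, smul_eq_mul, variationForm]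
  have h1 : ∑ j, ∑ k, (B (stdVec k)) j * inner ℝ (g j) (g k) =
      ∑ i, ∑ j, B (stdVec i) j * inner ℝ (g i) (g j) := by
    rw [Finset.sum_comm]
    simp only [real_inner_comm]
  rw [h1]
  simp only [ite_mul, one_mul, zero_mul, Finset.sum_ite_eq, Finset.mem_univ, if_true,
    real_inner_self_eq_norm_sq, Finset.mul_sum]
  simp only [two_mul, Finset.sum_add_distrib]
  ring

lemma abs_inner_le_sum_sq (g : Fin n → E p) (j k : Fin n) :
    |inner ℝ (g j) (g k)| ≤ ∑ i, ‖g i‖ ^ 2 := by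
  have h : ∀ l, ‖g l‖ ^ 2 ≤ ∑ i, ‖g i‖ ^ 2 := fun l =>
    Finset.single_le_sum (f := fun i => ‖g i‖ ^ 2) (fun i _ => sq_nonneg _) (Finset.mem_univ l)
  have := abs_real_inner_le_norm (g j) (g k)
  nlinarith [h j, h k, sq_nonneg (‖g j‖ - ‖g k‖)]

/-- First-order expansion of the transformed Dirichlet integrand, uniformly in the gradient. -/
lemma eventually_energy_expansion (p : ℕ) {ε : ℝ} (hε : 0 < ε) :
    ∀ᶠ B : E n →L[ℝ] E n in 𝓝 0, 0 < (1 + B).det ∧ ∀ g : Fin n → E p,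
      |(1 + B).det * ∑ i, ‖∑ j, Ring.inverse (1 + B) (stdVec i) j • g j‖ ^ 2
        - ∑ i, ‖g i‖ ^ 2 - variationForm B g| ≤ ε * ‖B‖ * ∑ i, ‖g i‖ ^ 2 := by
  have hdet : ∀ᶠ B : E n →L[ℝ] E n in 𝓝 0, 0 < (1 + B).det := by
    refine hasFDerivAt_det_one_add.continuousAt.eventually (lt_mem_nhds ?_)
    simp [ContinuousLinearMap.det]
  -- Each of the `n²` index pairs contributes an error of at most `δ‖B‖S`.
  set δ := ε / ((n : ℝ) ^ 2 + 1)
  have hδ : 0 < δ := by positivity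
  have hO : ∀ j k : Fin n, ∀ᶠ B : E n →L[ℝ] E n in 𝓝 0,
      |energyCoeff j k B - (if j = k then 1 else 0) -
        ((if j = k then (1 : ℝ) else 0) • traceCLM n - entryCLM j k - entryCLM k j) B|
        ≤ δ * ‖B‖ := by
    intro j k
    have := (hasFDerivAt_energyCoeff j k).isLittleO.def hδ
    filter_upwards [this] with B hB
    simpa only [energyCoeff_zero, sub_zero, Real.norm_eq_abs] using hB
  filter_upwards [hdet, eventually_all.2 fun j => eventually_all.2 fun k => hO j k] with B h1 h2
  refine ⟨h1, fun g => ?_⟩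
  set S := ∑ i, ‖g i‖ ^ 2 with hS
  have hS0 : 0 ≤ S := Finset.sum_nonneg fun i _ => sq_nonneg _
  have hS' : S = ∑ j, ∑ k, (if j = k then (1 : ℝ) else 0) * inner ℝ (g j) (g k) := by
    simp [hS]
  rw [det_mul_sum_sq_norm, ← sum_deriv_energyCoeff]
  nth_rewrite 1 [hS']
  simp only [← Finset.sum_sub_distrib, ← sub_mul]
  calc _ ≤ ∑ j : Fin n, ∑ k : Fin n, δ * ‖B‖ * S := by
        refine (Finset.abs_sum_le_sum_abs _ _).trans (Finset.sum_le_sum fun j _ => ?_)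
        refine (Finset.abs_sum_le_sum_abs _ _).trans (Finset.sum_le_sum fun k _ => ?_)
        rw [abs_mul]
        exact mul_le_mul (h2 j k) (abs_inner_le_sum_sq g j k) (abs_nonneg _) (by positivity)
    _ = ((n : ℝ) ^ 2 * δ) * ‖B‖ * S := by
        simp; ring
    _ ≤ ε * ‖B‖ * S := by
        have : (n : ℝ) ^ 2 * δ ≤ ε := by
          rw [mul_div_assoc', div_le_iff₀ (by positivity)]
          nlinarith
        gcongr

/-! ### Domain variations and stationarity -/

/-- A small smooth perturbation of the identity is a diffeomorphism. -/
lemma exists_isDiffeo_id_add {ξ : E n → E n} (hξ : ContDiff ℝ ∞ ξ) {K : NNReal} (hK : K < 1)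
    (hL : LipschitzWith K ξ) (hdet : ∀ x, 0 < (1 + fderiv ℝ ξ x).det) :
    ∃ Θ, IsDiffeo (fun x => x + ξ x) Θ := by
  have hsm : ContDiff ℝ ∞ (fun x => x + ξ x) := contDiff_id.add hξ
  have hfd : ∀ x, fderiv ℝ (fun x => x + ξ x) x = 1 + fderiv ℝ ξ x := fun x =>
    ((hasFDerivAt_id x).add (hξ.differentiable (by simp) x).hasFDerivAt).fderiv
  have happ : ApproximatesLinearOn (fun x => x + ξ x)
      ((ContinuousLinearEquiv.refl ℝ (E n)) : E n →L[ℝ] E n) univ K := by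
    intro x _ y _
    have := hL.dist_le_mul x y
    rw [dist_eq_norm, dist_eq_norm] at this
    have e1 : x + ξ x - (y + ξ y) - (x - y) = ξ x - ξ y := by abel
    change ‖x + ξ x - (y + ξ y) - (x - y)‖ ≤ K * ‖x - y‖
    rwa [e1]
  -- The identity has an inverse of norm one unless the space is trivial, so `K < 1` is the
  -- smallness that yields a global homeomorphism.
  have hc : Subsingleton (E n) ∨
      K < ‖((ContinuousLinearEquiv.refl ℝ (E n)).symm : E n →L[ℝ] E n)‖₊⁻¹ := by
    rcases subsingleton_or_nontrivial (E n) with h | h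
    · exact Or.inl h
    · right
      have : ‖((ContinuousLinearEquiv.refl ℝ (E n)).symm : E n →L[ℝ] E n)‖₊ = 1 :=
        NNReal.eq (ContinuousLinearMap.norm_id (𝕜 := ℝ) (E := E n))
      rw [this, inv_one]; exact hK
  let e : E n ≃ₜ E n := happ.toHomeomorph _ hc
  have he : ∀ x, e x = x + ξ x := fun x => rfl
  have hinv : ContDiff ℝ ∞ e.symm := by
    refine e.contDiff_symm (f₀' := fun x => ((1 + fderiv ℝ ξ x).toContinuousLinearEquivOfDetNeZero
      (hdet x).ne')) (fun x => ?_) hsm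
    rw [ContinuousLinearMap.coe_toContinuousLinearEquivOfDetNeZero, ← hfd]
    exact (hsm.differentiable (by simp) x).hasFDerivAt
  exact ⟨e.symm, hsm, hinv, e.symm_apply_apply, e.apply_symm_apply, fun x => by
    rw [hfd]; exact hdet x⟩

/-- `Ring.inverse` is zero off the units, so invertibility is first drawn from the determinant. This
identifies `DΘ(Ψ x)` with the inverse of `DΨ(x)`. -/
lemma ringInverse_apply_of_right_inv {B T : E n →L[ℝ] E n} (hdet : B.det ≠ 0)
    (h : ∀ v, B (T v) = v) : Ring.inverse B = T := by
  have h1 : B * T = 1 := ContinuousLinearMap.ext h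
  have hB : IsUnit B := by
    let e := B.toContinuousLinearEquivOfDetNeZero hdet
    refine ⟨⟨B, (e.symm : E n →L[ℝ] E n), ?_, ?_⟩, rfl⟩
    · ext v : 1; exact e.apply_symm_apply v
    · ext v : 1; exact e.symm_apply_apply v
  calc Ring.inverse B = Ring.inverse B * (B * T) := by rw [h1, mul_one]
    _ = T := by rw [← mul_assoc, Ring.inverse_mul_cancel _ hB, one_mul]

lemma IsDiffeo.image_eq_of_eqOn_compl {Ψ Θ : E n → E n} (h : IsDiffeo Ψ Θ) {s : Set (E n)}
    (hs : ∀ x, x ∉ s → Ψ x = x) : Ψ '' s = s := by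
  ext z
  constructor
  · rintro ⟨x, hx, rfl⟩
    by_contra hz
    exact hz (by rw [h.injective (hs _ hz)]; exact hx)
  · intro hz
    refine ⟨Θ z, ?_, h.right_inv z⟩
    by_contra hx
    have := hs _ hx
    rw [h.right_inv] at this
    exact hx (this ▸ hz)

lemma IsGlobalGradient.integrableOn_sq {u : E n → E p} {G : Fin n → E n → E p}
    (hG : IsGlobalGradient u G) (y : E n) (R : ℝ) :
    IntegrableOn (fun x => ∑ i, ‖G i x‖ ^ 2) (Metric.ball y R) :=
  integrable_finsetSum _ fun i _ =>
    (memLp_two_iff_integrable_sq_norm (memLp_ball (hG.memLp i) y R).1).1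
      (memLp_ball (hG.memLp i) y R)

/-- The energy of `u ∘ Ψ⁻¹`, written as an integral of the gradient of `u`. -/
lemma IsGlobalGradient.setIntegral_compGradient {u : E n → E p} {G : Fin n → E n → E p}
    (hG : IsGlobalGradient u G) {Ψ Θ : E n → E n} (h : IsDiffeo Ψ Θ) (y : E n) (R : ℝ)
    (hB : Ψ '' Metric.ball y R = Metric.ball y R) :
    IntegrableOn (fun x => (fderiv ℝ Ψ x).det *
      ∑ i, ‖∑ j, Ring.inverse (fderiv ℝ Ψ x) (stdVec i) j • G j x‖ ^ 2) (Metric.ball y R) ∧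
    energy (Metric.ball y R) (fun z => u (Θ z)) = ∫ x in Metric.ball y R, (fderiv ℝ Ψ x).det *
      ∑ i, ‖∑ j, Ring.inverse (fderiv ℝ Ψ x) (stdVec i) j • G j x‖ ^ 2 := by
  have hC := hG.comp_diffeo h
  have hf : ∀ x, (fderiv ℝ Ψ x).det • ∑ i, ‖compGradient Θ G i (Ψ x)‖ ^ 2 =
      (fderiv ℝ Ψ x).det *
        ∑ i, ‖∑ j, Ring.inverse (fderiv ℝ Ψ x) (stdVec i) j • G j x‖ ^ 2 := by
    intro x
    rw [ringInverse_apply_of_right_inv (h.det_pos x).ne' (h.fderiv_inv_apply x)]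
    simp only [compGradient, h.left_inv, smul_eq_mul]
  constructor
  · have := hC.integrableOn_sq y R
    rw [← hB, h.integrableOn_image Metric.isOpen_ball.measurableSet] at this
    simpa only [hf] using this
  · rw [hC.energy_ball]
    conv_lhs => rw [← hB]
    rw [h.setIntegral_image Metric.isOpen_ball.measurableSet]
    simp only [hf]

lemma IsEnergyMinimizing.memW12_ball {N : Set (E p)} {u : E n → E p}
    (hu : IsEnergyMinimizing univ N u) (y : E n) {R : ℝ} (hR : 0 < R) :
    MemW12 (Metric.ball y R) N u :=
  (hu y R hR (subset_univ _)).1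

lemma IsEnergyMinimizing.exists_isGlobalGradient {N : Set (E p)} {u : E n → E p}
    (hu : IsEnergyMinimizing univ N u) : ∃ G, IsGlobalGradient u G :=
  EnergyMin.exists_isGlobalGradient fun _ hR =>
    ⟨(hu.memW12_ball 0 hR).1, (hu.memW12_ball 0 hR).2.1⟩

lemma IsEnergyMinimizing.ae_mem {N : Set (E p)} {u : E n → E p}
    (hu : IsEnergyMinimizing univ N u) : ∀ᵐ x, u x ∈ N := by
  have h : ∀ k : ℕ, ∀ᵐ x, x ∈ Metric.ball (0 : E n) ((k : ℝ) + 1) → u x ∈ N := fun k =>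
    (ae_restrict_iff' Metric.isOpen_ball.measurableSet).1
      (hu.memW12_ball 0 (by positivity : (0 : ℝ) < (k : ℝ) + 1)).2.2
  filter_upwards [ae_all_iff.2 h] with x hx
  refine hx ⌈‖x‖⌉₊ ?_
  rw [mem_ball_zero_iff]
  exact (Nat.le_ceil _).trans_lt (lt_add_one _)

/-- Comparison of a minimizing map with its composition with a diffeomorphism that is the
identity near the complement of a ball. -/
lemma IsEnergyMinimizing.energy_le_comp {N : Set (E p)} {u : E n → E p}
    (hu : IsEnergyMinimizing univ N u) {G : Fin n → E n → E p} (hG : IsGlobalGradient u G)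
    {Ψ Θ : E n → E n} (h : IsDiffeo Ψ Θ) {K : Set (E n)} (hK : IsClosed K) {y : E n} {R : ℝ}
    (hR : 0 < R) (hKR : K ⊆ Metric.ball y R) (hid : ∀ x, x ∉ K → Ψ x = x) :
    energy (Metric.ball y R) u ≤ energy (Metric.ball y R) (fun z => u (Θ z)) := by
  have hC := hG.comp_diffeo h
  -- The values stay in `N` because `Θ` pulls null sets back to null sets; `Kᶜ` is the neighbourhood
  -- of the sphere on which `Θ` is the identity.
  refine (hu y R hR (subset_univ _)).2 _
    ⟨memLp_ball hC.memLp_fun y R, ⟨_, hC.isL2WeakGradient y R⟩, ?_⟩ ⟨Kᶜ, hK.isOpen_compl, ?_, ?_⟩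
  · exact ae_restrict_of_ae (h.quasiMeasurePreserving_inv.ae hu.ae_mem)
  · intro x hx hxK
    have h1 := hKR hxK
    rw [Metric.mem_sphere] at hx
    rw [Metric.mem_ball] at h1
    exact h1.ne hx
  · refine (ae_restrict_iff' (hK.isOpen_compl.measurableSet.inter
      Metric.isOpen_ball.measurableSet)).2 (Eventually.of_forall fun x hx => ?_)
    have : Θ x = x := by
      have := h.left_inv x
      rwa [hid x hx.1] at this
    rw [this]

lemma aestronglyMeasurable_variationForm {u : E n → E p} {G : Fin n → E n → E p}
    (hG : IsGlobalGradient u G) {ζ : E n → E n} (hζ : ContDiff ℝ ∞ ζ) :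
    AEStronglyMeasurable (fun x => variationForm (fderiv ℝ ζ x) fun i => G i x) volume := by
  have hGm := fun i => (hG.locallyIntegrable i).aestronglyMeasurable
  have hc := hζ.continuous_fderiv (by simp)
  unfold variationForm
  refine AEStronglyMeasurable.sub ?_ ?_
  · refine AEStronglyMeasurable.mul ((traceCLM n).continuous.comp hc).aestronglyMeasurable ?_
    exact Finset.aestronglyMeasurable_fun_sum _ fun i _ => (hGm i).norm.pow 2
  · refine AEStronglyMeasurable.const_mul ?_ 2
    refine Finset.aestronglyMeasurable_fun_sum _ fun i _ =>
      Finset.aestronglyMeasurable_fun_sum _ fun j _ => ?_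
    refine AEStronglyMeasurable.mul (Continuous.aestronglyMeasurable ?_) ((hGm i).inner (hGm j))
    exact (EuclideanSpace.proj (𝕜 := ℝ) j).continuous.comp (hc.clm_apply continuous_const)

lemma abs_variationForm_le (B : E n →L[ℝ] E n) (g : Fin n → E p) :
    |variationForm B g| ≤ (‖traceCLM n‖ + 2 * n ^ 2) * ‖B‖ * ∑ i, ‖g i‖ ^ 2 := by
  set S := ∑ i, ‖g i‖ ^ 2
  have hS0 : 0 ≤ S := Finset.sum_nonneg fun i _ => sq_nonneg _
  have h1 : |traceCLM n B * S| ≤ ‖traceCLM n‖ * ‖B‖ * S := by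
    rw [abs_mul, abs_of_nonneg hS0]
    exact mul_le_mul_of_nonneg_right ((traceCLM n).le_opNorm B) hS0
  have h2 : |∑ i, ∑ j, B (stdVec i) j * inner ℝ (g i) (g j)| ≤ (n : ℝ) ^ 2 * ‖B‖ * S := by
    calc _ ≤ ∑ i : Fin n, ∑ j : Fin n, ‖B‖ * S := by
          refine (Finset.abs_sum_le_sum_abs _ _).trans (Finset.sum_le_sum fun i _ => ?_)
          refine (Finset.abs_sum_le_sum_abs _ _).trans (Finset.sum_le_sum fun j _ => ?_)
          rw [abs_mul]
          refine mul_le_mul ?_ (abs_inner_le_sum_sq g i j) (abs_nonneg _) (norm_nonneg _)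
          calc |B (stdVec i) j| ≤ ‖B (stdVec i)‖ := PiLp.norm_apply_le (B (stdVec i)) j
            _ ≤ ‖B‖ * ‖stdVec i‖ := B.le_opNorm _
            _ = ‖B‖ := by simp
      _ = _ := by simp; ring
  unfold variationForm
  calc _ ≤ |traceCLM n B * S| + |2 * ∑ i, ∑ j, B (stdVec i) j * inner ℝ (g i) (g j)| :=
        abs_sub _ _
    _ ≤ ‖traceCLM n‖ * ‖B‖ * S + 2 * ((n : ℝ) ^ 2 * ‖B‖ * S) := by
        rw [abs_mul 2, abs_two]; gcongr
    _ = _ := by ring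

/-- Energy minimizing maps are stationary with respect to variations of the domain. -/
theorem IsEnergyMinimizing.integral_variationForm_eq_zero {N : Set (E p)} {u : E n → E p}
    (hu : IsEnergyMinimizing univ N u) {G : Fin n → E n → E p} (hG : IsGlobalGradient u G)
    {ζ : E n → E n} (hζ : ContDiff ℝ ∞ ζ) (hc : HasCompactSupport ζ) :
    ∫ x, variationForm (fderiv ℝ ζ x) (fun i => G i x) = 0 := by
  obtain ⟨R, hRpos, hR⟩ : ∃ R : ℝ, 0 < R ∧ tsupport ζ ⊆ Metric.ball 0 R := by
    obtain ⟨r, hr⟩ := hc.isCompact.isBounded.subset_ball (0 : E n)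
    exact ⟨max r 1, by positivity, hr.trans (Metric.ball_subset_ball (le_max_left _ _))⟩
  obtain ⟨K, hK⟩ := ContDiff.lipschitzWith_of_hasCompactSupport hc hζ (by simp)
  set B := Metric.ball (0 : E n) R
  set v := fun x => variationForm (fderiv ℝ ζ x) (fun i => G i x)
  set e := fun x => ∑ i, ‖G i x‖ ^ 2
  have he0 : ∀ x, 0 ≤ e x := fun x => Finset.sum_nonneg fun i _ => sq_nonneg _
  have hKf : ∀ x, ‖fderiv ℝ ζ x‖ ≤ K := fun x => norm_fderiv_le_of_lipschitz ℝ hK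
  have hei : IntegrableOn e B := hG.integrableOn_sq 0 R
  have hvi : IntegrableOn v B := by
    refine Integrable.mono' (hei.const_mul ((‖traceCLM n‖ + 2 * n ^ 2) * K))
      (aestronglyMeasurable_variationForm hG hζ).restrict (Eventually.of_forall fun x => ?_)
    refine (abs_variationForm_le _ _).trans ?_
    exact mul_le_mul_of_nonneg_right
      (mul_le_mul_of_nonneg_left (hKf x) (by positivity)) (he0 x)
  have hvB : ∫ x, v x = ∫ x in B, v x := by
    refine (setIntegral_eq_integral_of_forall_compl_eq_zero fun x hx => ?_).symm
    have : fderiv ℝ ζ x = 0 :=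
      image_eq_zero_of_notMem_tsupport fun h => hx (hR (tsupport_fderiv_subset ℝ h))
    simp [v, this, variationForm]
  rw [hvB]
  set a := ∫ x in B, v x
  set Q := ∫ x in B, e x
  have hQ0 : 0 ≤ Q := integral_nonneg he0
  -- Minimality against `u ∘ (id + sζ)⁻¹`, expanded to first order: `a` is the first variation, and
  -- the other term bounds the remainder.
  have key : ∀ ε : ℝ, 0 < ε → ∃ s₀ : ℝ, 0 < s₀ ∧ ∀ s : ℝ, |s| ≤ s₀ →
      0 ≤ s * a + ε * (|s| * K) * Q := by
    intro ε hε
    obtain ⟨δ, hδ, hexp⟩ := Metric.eventually_nhds_iff.1 (eventually_energy_expansion (n := n) p hε)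
    -- The first bound keeps `s • Dζ` in the range of the expansion, the second makes `sζ` a
    -- contraction; `K + 1` covers `K = 0`.
    refine ⟨min (δ / (2 * (K + 1))) (1 / (2 * (K + 1))), by positivity, fun s hs => ?_⟩
    have hK1 : (0 : ℝ) < 2 * (K + 1) := by positivity
    have hs1 : |s| * K < δ := by
      have := (le_div_iff₀ hK1).1 (hs.trans (min_le_left _ _))
      nlinarith [abs_nonneg s, K.coe_nonneg]
    have hs2 : |s| * K < 1 := by
      have := (le_div_iff₀ hK1).1 (hs.trans (min_le_right _ _))
      nlinarith [abs_nonneg s, K.coe_nonneg]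
    have hBn : ∀ x, ‖s • fderiv ℝ ζ x‖ ≤ |s| * K := fun x => by
      rw [norm_smul, Real.norm_eq_abs]
      exact mul_le_mul_of_nonneg_left (hKf x) (abs_nonneg s)
    have hB := fun x => hexp (y := s • fderiv ℝ ζ x) (by
      rw [dist_zero_right]; exact (hBn x).trans_lt hs1)
    have hfs : ∀ x, fderiv ℝ (fun x => s • ζ x) x = s • fderiv ℝ ζ x := fun x =>
      fderiv_fun_const_smul (hζ.differentiable (by simp) x) s
    obtain ⟨Θ, hΘ⟩ := exists_isDiffeo_id_add (ξ := fun x => s • ζ x) (hζ.const_smul s)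
      (K := ‖s‖₊ * K) (by
        rw [← NNReal.coe_lt_coe]; push_cast; exact hs2)
      (LipschitzWith.of_dist_le_mul fun x y => by
        rw [dist_smul₀]; push_cast; rw [mul_assoc]
        exact mul_le_mul_of_nonneg_left (hK.dist_le_mul x y) (norm_nonneg _))
      (fun x => by rw [hfs]; exact (hB x).1)
    set Ψ := fun x => x + s • ζ x
    have hfΨ : ∀ x, fderiv ℝ Ψ x = 1 + s • fderiv ℝ ζ x := fun x => by
      rw [← hfs]
      exact ((hasFDerivAt_id x).add
        ((hζ.const_smul s).differentiable (by simp) x).hasFDerivAt).fderiv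
    have hid : ∀ x, x ∉ tsupport ζ → Ψ x = x := fun x hx => by
      simp [Ψ, image_eq_zero_of_notMem_tsupport hx]
    have himg : Ψ '' B = B := hΘ.image_eq_of_eqOn_compl fun x hx => hid x fun h => hx (hR h)
    have hle := hu.energy_le_comp hG hΘ (isClosed_tsupport ζ) hRpos hR hid
    obtain ⟨hint, heq⟩ := hG.setIntegral_compGradient hΘ 0 R himg
    rw [heq, hG.energy_ball] at hle
    have hbound : ∫ x in B, (fderiv ℝ Ψ x).det *
        ∑ i, ‖∑ j, Ring.inverse (fderiv ℝ Ψ x) (stdVec i) j • G j x‖ ^ 2 ≤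
        ∫ x in B, (e x + (s * v x + ε * (|s| * K) * e x)) := by
      refine integral_mono hint
        (hei.add ((hvi.const_mul s).add (hei.const_mul _))) fun x => ?_
      have h1 := (abs_le.1 ((hB x).2 fun i => G i x)).2
      rw [variationForm_smul] at h1
      have h2 : ε * ‖s • fderiv ℝ ζ x‖ * ∑ i, ‖G i x‖ ^ 2 ≤ ε * (|s| * K) * e x :=
        mul_le_mul_of_nonneg_right (mul_le_mul_of_nonneg_left (hBn x) hε.le) (he0 x)
      rw [← hfΨ] at h1
      change _ - e x - s * v x ≤ _ at h1
      linarith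
    have hsplit : ∫ x in B, (e x + (s * v x + ε * (|s| * K) * e x)) =
        Q + (s * a + ε * (|s| * K) * Q) := by
      have hi : IntegrableOn (fun x => s * v x + ε * (|s| * K) * e x) B :=
        (hvi.const_mul s).add (hei.const_mul _)
      rw [integral_add hei hi, integral_add (hvi.const_mul s) (hei.const_mul _),
        integral_const_mul, integral_const_mul]
    rw [hsplit] at hbound
    have := hle.trans hbound
    change Q ≤ _ at this
    linarith
  -- Both signs of `s` are admissible; dividing by `|s|` bounds `a` from both sides.
  have habs : ∀ ε : ℝ, 0 < ε → |a| ≤ ε * (K * Q) := by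
    intro ε hε
    obtain ⟨s, hs, h⟩ := key ε hε
    have h1 := h s (abs_of_pos hs).le
    have h2 := h (-s) (by rw [abs_neg]; exact (abs_of_pos hs).le)
    rw [abs_neg] at h2
    rw [abs_of_pos hs] at h1 h2
    rw [abs_le]
    constructor
    · by_contra! hlt
      nlinarith
    · by_contra! hlt
      nlinarith
  have hz : |a| ≤ 0 := by
    have hlim : Tendsto (fun ε : ℝ => ε * (K * Q)) (𝓝[>] 0) (𝓝 0) := by
      have : Tendsto (fun ε : ℝ => ε * (K * Q)) (𝓝 0) (𝓝 (0 * (K * Q))) :=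
        tendsto_id.mul_const _
      rw [zero_mul] at this
      exact this.mono_left nhdsWithin_le_nhds
    exact ge_of_tendsto hlim (eventually_mem_nhdsWithin.mono fun ε hε => habs ε hε)
  exact abs_eq_zero.1 (le_antisymm hz (abs_nonneg a))

/-! ### Radial vector fields -/

/-- The derivative of a map in the direction of `x - y`, in terms of its gradient `G`. -/
noncomputable def radialDeriv (y : E n) (G : Fin n → E n → E p) (x : E n) : E p :=
  ∑ i, (x - y) i • G i x

/-- A profile in `‖x - y‖ ^ 2` rather than `‖x - y‖` keeps the field smooth at the centre. -/
lemma contDiff_radial (y : E n) {h : ℝ → ℝ} (hh : ContDiff ℝ ∞ h) :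
    ContDiff ℝ ∞ (fun x : E n => h (‖x - y‖ ^ 2) • (x - y)) :=
  (hh.comp ((contDiff_id.sub contDiff_const).norm_sq ℝ)).smul (contDiff_id.sub contDiff_const)

lemma fderiv_radial (y : E n) {h : ℝ → ℝ} (hh : ContDiff ℝ ∞ h) (x v : E n) :
    fderiv ℝ (fun x : E n => h (‖x - y‖ ^ 2) • (x - y)) x v =
      h (‖x - y‖ ^ 2) • v + (deriv h (‖x - y‖ ^ 2) * (2 * inner ℝ (x - y) v)) • (x - y) := by
  have h1 : HasFDerivAt (fun x : E n => x - y) (ContinuousLinearMap.id ℝ (E n)) x :=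
    (hasFDerivAt_id x).sub_const y
  have h2 := h1.norm_sq
  have h3 : HasDerivAt h (deriv h (‖x - y‖ ^ 2)) (‖x - y‖ ^ 2) :=
    (hh.differentiable (by simp) _).hasDerivAt
  have h4 := (h3.comp_hasFDerivAt x h2).smul h1
  have h5 := congrArg (fun L : E n →L[ℝ] E n => L v) h4.fderiv
  refine Eq.trans h5 ?_
  simp [inner_sub_left]

lemma inner_stdVec (w : E n) (i : Fin n) : inner ℝ w (stdVec i) = w i := by
  simp [stdVec, EuclideanSpace.inner_single_right]

lemma sum_sq_eq_norm_sq (w : E n) : ∑ i, w i * w i = ‖w‖ ^ 2 := by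
  rw [EuclideanSpace.norm_sq_eq]
  exact Finset.sum_congr rfl fun i _ => by rw [Real.norm_eq_abs, sq_abs, sq]

/-- With `w = x - y`, the derivative of the field is `h·I + 2h' w⊗w`: its trace is `nh + 2h'|w|²`,
and the rank-one part produces the radial derivative. -/
lemma variationForm_radial (y : E n) {h : ℝ → ℝ} (hh : ContDiff ℝ ∞ h)
    (G : Fin n → E n → E p) (x : E n) :
    variationForm (fderiv ℝ (fun x : E n => h (‖x - y‖ ^ 2) • (x - y)) x) (fun i => G i x) =
      ((n - 2) * h (‖x - y‖ ^ 2) + 2 * ‖x - y‖ ^ 2 * deriv h (‖x - y‖ ^ 2)) *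
        ∑ i, ‖G i x‖ ^ 2 - 4 * deriv h (‖x - y‖ ^ 2) * ‖radialDeriv y G x‖ ^ 2 := by
  set a := h (‖x - y‖ ^ 2)
  set b := deriv h (‖x - y‖ ^ 2)
  set w := x - y
  have hD : ∀ i j, fderiv ℝ (fun x : E n => h (‖x - y‖ ^ 2) • (x - y)) x (stdVec i) j =
      a * (if j = i then 1 else 0) + 2 * b * (w i * w j) := by
    intro i j
    rw [fderiv_radial y hh, inner_stdVec]
    simp only [PiLp.add_apply, PiLp.smul_apply, smul_eq_mul, stdVec_apply]
    change a * _ + b * (2 * w i) * w j = _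
    ring
  have ht : traceCLM n (fderiv ℝ (fun x : E n => h (‖x - y‖ ^ 2) • (x - y)) x) =
      n * a + 2 * b * ‖w‖ ^ 2 := by
    rw [traceCLM_apply, ← sum_sq_eq_norm_sq w]
    simp only [hD, Finset.sum_add_distrib, ← Finset.mul_sum]
    simp; ring
  have hq : ∑ i, ∑ j, fderiv ℝ (fun x : E n => h (‖x - y‖ ^ 2) • (x - y)) x (stdVec i) j *
      inner ℝ (G i x) (G j x) = a * ∑ i, ‖G i x‖ ^ 2 + 2 * b * ‖radialDeriv y G x‖ ^ 2 := by
    simp only [hD, radialDeriv, sq_norm_sum_smul, add_mul, Finset.sum_add_distrib]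
    congr 1
    · simp [Finset.mul_sum]
    · simp only [Finset.mul_sum, mul_assoc]; rfl
  rw [variationForm, ht, hq]
  ring

lemma hasCompactSupport_of_eq_zero_of_le {V : Type*} [NormedAddCommGroup V] (y : E n) {R : ℝ}
    {f : E n → V} (h : ∀ x, R ≤ ‖x - y‖ → f x = 0) : HasCompactSupport f := by
  refine HasCompactSupport.intro (isCompact_closedBall y R) fun x hx => h x ?_
  rw [Metric.mem_closedBall, dist_eq_norm, not_le] at hx
  exact hx.le

/-- The stationarity identity for radial vector fields. -/
lemma IsEnergyMinimizing.integral_radial {N : Set (E p)} {u : E n → E p}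
    (hu : IsEnergyMinimizing univ N u) {G : Fin n → E n → E p} (hG : IsGlobalGradient u G)
    (y : E n) {h : ℝ → ℝ} (hh : ContDiff ℝ ∞ h) {R : ℝ} (hR : 0 < R)
    (h0 : ∀ t, R ^ 2 ≤ t → h t = 0) :
    ∫ x, (((n - 2) * h (‖x - y‖ ^ 2) + 2 * ‖x - y‖ ^ 2 * deriv h (‖x - y‖ ^ 2)) *
        ∑ i, ‖G i x‖ ^ 2 - 4 * deriv h (‖x - y‖ ^ 2) * ‖radialDeriv y G x‖ ^ 2) = 0 := by
  rw [← hu.integral_variationForm_eq_zero hG (contDiff_radial y hh)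
    (hasCompactSupport_of_eq_zero_of_le y (R := R) fun x hx => by
      rw [h0 _ (by gcongr), zero_smul])]
  exact integral_congr_ae (Eventually.of_forall fun x => (variationForm_radial y hh G x).symm)

lemma sq_norm_radialDeriv_le (y : E n) (G : Fin n → E n → E p) (x : E n) :
    ‖radialDeriv y G x‖ ^ 2 ≤ ‖x - y‖ ^ 2 * ∑ i, ‖G i x‖ ^ 2 := by
  have h1 : ‖radialDeriv y G x‖ ≤ ∑ i, |(x - y) i| * ‖G i x‖ := by
    refine (norm_sum_le _ _).trans (le_of_eq ?_)
    simp [norm_smul]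
  have h2 := Finset.sum_mul_sq_le_sq_mul_sq Finset.univ (fun i => |(x - y) i|) (fun i => ‖G i x‖)
  have h3 : ∑ i, |(x - y) i| ^ 2 = ‖x - y‖ ^ 2 := by
    rw [← sum_sq_eq_norm_sq]
    exact Finset.sum_congr rfl fun i _ => by rw [sq_abs, sq]
  rw [h3] at h2
  exact (pow_le_pow_left₀ (norm_nonneg _) h1 2).trans h2

lemma IsGlobalGradient.aestronglyMeasurable_radialDeriv {u : E n → E p} {G : Fin n → E n → E p}
    (hG : IsGlobalGradient u G) (y : E n) : AEStronglyMeasurable (radialDeriv y G) volume := by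
  refine Finset.aestronglyMeasurable_fun_sum _ fun i _ => ?_
  have h : Continuous fun x : E n => (x - y) i :=
    (EuclideanSpace.proj (𝕜 := ℝ) i).continuous.comp (continuous_id.sub continuous_const)
  exact h.aestronglyMeasurable.smul (hG.locallyIntegrable i).aestronglyMeasurable

lemma IsGlobalGradient.integrableOn_radialDeriv {u : E n → E p} {G : Fin n → E n → E p}
    (hG : IsGlobalGradient u G) (y : E n) (R : ℝ) :
    IntegrableOn (fun x => ‖radialDeriv y G x‖ ^ 2) (Metric.ball y R) := by
  refine Integrable.mono' ((hG.integrableOn_sq y R).const_mul (R ^ 2)) ?_ ?_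
  · exact (hG.aestronglyMeasurable_radialDeriv y).restrict.norm.pow 2
  · refine (ae_restrict_iff' Metric.isOpen_ball.measurableSet).2 (Eventually.of_forall ?_)
    intro x hx
    rw [mem_ball_iff_norm] at hx
    rw [Real.norm_eq_abs, abs_of_nonneg (sq_nonneg _)]
    refine (sq_norm_radialDeriv_le y G x).trans ?_
    refine mul_le_mul_of_nonneg_right ?_ (Finset.sum_nonneg fun i _ => sq_nonneg _)
    gcongr

/-! ### The monotonicity formula -/

/-- The integral of `f` against the rescaled radial cutoff `η(|x - y|² / ρ²)`. -/
noncomputable def cutoffIntegral (η : ℝ → ℝ) (f : E n → ℝ) (y : E n) (ρ : ℝ) : ℝ :=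
  ∫ x, η (‖x - y‖ ^ 2 / ρ ^ 2) * f x

lemma integrable_radial_mul {f : E n → ℝ} {y : E n}
    (hf : ∀ R, IntegrableOn f (Metric.ball y R)) {g : E n → ℝ} (hg : Continuous g) {R : ℝ}
    (h0 : ∀ x, R < ‖x - y‖ → g x = 0) : Integrable (fun x => g x * f x) := by
  have hi : IntegrableOn (fun x => g x * f x) (Metric.closedBall y R) :=
    ((hf (R + 1)).mono_set (Metric.closedBall_subset_ball (by linarith))).continuousOn_mul
      hg.continuousOn (isCompact_closedBall y R)
  rw [← integrableOn_iff_integrable_of_support_subset]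
  · exact hi
  · intro x hx
    rw [Metric.mem_closedBall, dist_eq_norm]
    by_contra! hlt
    exact hx (by simp [h0 x hlt])

lemma deriv_eq_zero_of_one_lt {η : ℝ → ℝ} (h0 : ∀ t, 1 ≤ t → η t = 0) {t : ℝ} (ht : 1 < t) :
    deriv η t = 0 := by
  have : η =ᶠ[𝓝 t] fun _ => 0 := by
    filter_upwards [lt_mem_nhds ht] with s hs using h0 s hs.le
  rw [this.deriv_eq]; simp

lemma one_lt_sq_div_sq {r τ : ℝ} (hτ : 0 < τ) (h : τ < r) : 1 < r ^ 2 / τ ^ 2 := by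
  rw [one_lt_div (by positivity)]
  gcongr

lemma continuous_comp_radial {η : ℝ → ℝ} (hη : Continuous η) (y : E n) (ρ : ℝ) :
    Continuous fun x : E n => η (‖x - y‖ ^ 2 / ρ ^ 2) :=
  hη.comp (by fun_prop)

lemma hasDerivAt_cutoffIntegral {η : ℝ → ℝ} (hη : ContDiff ℝ ∞ η) (h0 : ∀ t, 1 ≤ t → η t = 0)
    {f : E n → ℝ} {y : E n} (hfm : AEStronglyMeasurable f volume)
    (hf : ∀ R, IntegrableOn f (Metric.ball y R)) {ρ : ℝ} (hρ : 0 < ρ) :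
    HasDerivAt (cutoffIntegral η f y)
      (∫ x, deriv η (‖x - y‖ ^ 2 / ρ ^ 2) * (-2 * ‖x - y‖ ^ 2 / ρ ^ 3) * f x) ρ := by
  have hd : Continuous (deriv η) := hη.continuous_deriv (by simp)
  obtain ⟨C, hC⟩ := (isCompact_Icc (a := (0 : ℝ)) (b := 1)).exists_bound_of_continuousOn
    hd.continuousOn
  have hC0 : 0 ≤ C := (norm_nonneg _).trans (hC 0 (by simp))
  -- For `τ` in `(ρ/2, 2ρ)` the derivative vanishes where `|x - y| > τ`; elsewhere `2|x - y|²/τ³ ≤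
  -- 2/τ ≤ 4/ρ`, and `C` bounds `η'` on `[0, 1]`.
  refine (hasDerivAt_integral_of_dominated_loc_of_deriv_le
    (bound := fun x => (Metric.ball y (2 * ρ)).indicator (fun x => 4 * C / ρ * |f x|) x)
    (F' := fun τ x => deriv η (‖x - y‖ ^ 2 / τ ^ 2) * (-2 * ‖x - y‖ ^ 2 / τ ^ 3) * f x)
    (Ioo_mem_nhds (show ρ / 2 < ρ by linarith) (show ρ < 2 * ρ by linarith))
    ?_ ?_ ?_ ?_ ?_ ?_).2
  · exact Eventually.of_forall fun τ =>
      (continuous_comp_radial hη.continuous y τ).aestronglyMeasurable.mul hfm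
  · exact integrable_radial_mul hf (continuous_comp_radial hη.continuous y ρ) (R := ρ)
      fun x hx => h0 _ (one_lt_sq_div_sq hρ hx).le
  · refine AEStronglyMeasurable.mul (Continuous.aestronglyMeasurable ?_) hfm
    exact (continuous_comp_radial hd y ρ).mul (by fun_prop)
  · refine Eventually.of_forall fun x τ hτ => ?_
    have hτ0 : 0 < τ := by linarith [hτ.1]
    by_cases hx : ‖x - y‖ ≤ τ
    · have hxb : x ∈ Metric.ball y (2 * ρ) := by
        rw [mem_ball_iff_norm]; exact hx.trans_lt hτ.2
      rw [indicator_of_mem hxb, norm_mul, norm_mul, Real.norm_eq_abs (f x)]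
      refine mul_le_mul_of_nonneg_right ?_ (abs_nonneg _)
      have h1 : ‖x - y‖ ^ 2 / τ ^ 2 ≤ 1 := by
        rw [div_le_one (by positivity)]; gcongr
      have h2 := hC (‖x - y‖ ^ 2 / τ ^ 2) ⟨by positivity, h1⟩
      have h3 : ‖-2 * ‖x - y‖ ^ 2 / τ ^ 3‖ ≤ 4 / ρ := by
        have : -2 * ‖x - y‖ ^ 2 / τ ^ 3 = -(2 / τ * (‖x - y‖ ^ 2 / τ ^ 2)) := by
          field_simp
        rw [this, norm_neg, Real.norm_of_nonneg (by positivity)]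
        calc 2 / τ * (‖x - y‖ ^ 2 / τ ^ 2) ≤ 2 / τ * 1 := by gcongr
          _ ≤ 4 / ρ := by
            rw [mul_one, div_le_div_iff₀ hτ0 hρ]; linarith [hτ.1]
      calc _ ≤ C * (4 / ρ) := by gcongr
        _ = _ := by ring
    · rw [deriv_eq_zero_of_one_lt h0 (one_lt_sq_div_sq hτ0 (not_le.1 hx))]
      simp only [zero_mul, norm_zero]
      exact indicator_nonneg (fun x _ => by positivity) x
  · rw [integrable_indicator_iff Metric.isOpen_ball.measurableSet]
    exact (hf _).abs.const_mul _
  · refine Eventually.of_forall fun x τ hτ => ?_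
    have hτ0 : 0 < τ := by linarith [hτ.1]
    have h1 : HasDerivAt (fun τ : ℝ => ‖x - y‖ ^ 2 / τ ^ 2) (-2 * ‖x - y‖ ^ 2 / τ ^ 3) τ := by
      have := (hasDerivAt_const τ (‖x - y‖ ^ 2)).div (hasDerivAt_pow 2 τ) (by positivity)
      convert! this using 1
      simp
      field_simp
    exact (((hη.differentiable (by simp) _).hasDerivAt.comp τ h1)).mul_const (f x)

lemma IsGlobalGradient.aestronglyMeasurable_sq {u : E n → E p} {G : Fin n → E n → E p}
    (hG : IsGlobalGradient u G) : AEStronglyMeasurable (fun x => ∑ i, ‖G i x‖ ^ 2) volume :=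
  Finset.aestronglyMeasurable_fun_sum _ fun i _ =>
    (hG.locallyIntegrable i).aestronglyMeasurable.norm.pow 2

/-- The monotonicity formula for the cut-off energy: its derivative controls that of the
cut-off integral of the squared radial derivative. -/
lemma IsEnergyMinimizing.cutoffIntegral_sub_le {N : Set (E p)} {u : E n → E p}
    (hu : IsEnergyMinimizing univ N u) {G : Fin n → E n → E p} (hG : IsGlobalGradient u G)
    (y : E n) {η : ℝ → ℝ} (hη : ContDiff ℝ ∞ η) (h0 : ∀ t, 1 ≤ t → η t = 0) (hanti : Antitone η)
    {σ ρ : ℝ} (hσ : 0 < σ) (hσρ : σ ≤ ρ) :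
    cutoffIntegral η (fun x => ‖radialDeriv y G x‖ ^ 2) y ρ -
        cutoffIntegral η (fun x => ‖radialDeriv y G x‖ ^ 2) y σ ≤
      ρ ^ n / 2 * (ρ ^ (2 - (n : ℤ)) * cutoffIntegral η (fun x => ∑ i, ‖G i x‖ ^ 2) y ρ -
        σ ^ (2 - (n : ℤ)) * cutoffIntegral η (fun x => ∑ i, ‖G i x‖ ^ 2) y σ) := by
  set W := fun x => ‖radialDeriv y G x‖ ^ 2
  set S := fun x => ∑ i, ‖G i x‖ ^ 2
  have hW : ∀ R, IntegrableOn W (Metric.ball y R) := hG.integrableOn_radialDeriv y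
  have hS : ∀ R, IntegrableOn S (Metric.ball y R) := hG.integrableOn_sq y
  have hWm : AEStronglyMeasurable W volume := (hG.aestronglyMeasurable_radialDeriv y).norm.pow 2
  have hSm : AEStronglyMeasurable S volume := hG.aestronglyMeasurable_sq
  have hd : Continuous (deriv η) := hη.continuous_deriv (by simp)
  have hdnonpos : ∀ t, deriv η t ≤ 0 := fun t => hanti.deriv_nonpos
  -- The claim is `F σ ≤ F ρ`. The scaled cut-off energy has derivative `-4τ^(-n-1) A τ ≥ 0`, and
  -- the cut-off integral of `W` has derivative at most `-2 A τ / τ`, which is `τ^n/2` times the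
  -- former; `τ ≤ ρ` allows `ρ^n/2`.
  let F : ℝ → ℝ := fun τ => ρ ^ n / 2 * (τ ^ (2 - (n : ℤ)) * cutoffIntegral η S y τ) -
    cutoffIntegral η W y τ
  let A : ℝ → ℝ := fun τ => ∫ x, deriv η (‖x - y‖ ^ 2 / τ ^ 2) * W x
  have hder : ∀ τ, 0 < τ → ∃ k, HasDerivAt F
      (ρ ^ n / 2 * (-4 * τ ^ (-(n : ℤ) - 1) * A τ) - k) τ ∧ k ≤ -2 / τ * A τ := by
    intro τ hτ
    have hWd := hasDerivAt_cutoffIntegral hη h0 hWm hW hτ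
    have hSd := hasDerivAt_cutoffIntegral hη h0 hSm hS hτ
    have hJ := (hasDerivAt_zpow (2 - (n : ℤ)) τ (Or.inl hτ.ne')).mul hSd
    have hzero : ∀ x, τ < ‖x - y‖ → deriv η (‖x - y‖ ^ 2 / τ ^ 2) = 0 := fun x hx =>
      deriv_eq_zero_of_one_lt h0 (one_lt_sq_div_sq hτ hx)
    have iA : Integrable (fun x => deriv η (‖x - y‖ ^ 2 / τ ^ 2) * W x) :=
      integrable_radial_mul hW (continuous_comp_radial hd y τ) hzero
    have iS : Integrable (fun x => η (‖x - y‖ ^ 2 / τ ^ 2) * S x) :=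
      integrable_radial_mul hS (continuous_comp_radial hη.continuous y τ) (R := τ)
        fun x hx => h0 _ (one_lt_sq_div_sq hτ hx).le
    have iD : ∀ f : E n → ℝ, (∀ R, IntegrableOn f (Metric.ball y R)) → Integrable (fun x =>
        deriv η (‖x - y‖ ^ 2 / τ ^ 2) * (-2 * ‖x - y‖ ^ 2 / τ ^ 3) * f x) := fun f hf =>
      integrable_radial_mul hf ((continuous_comp_radial hd y τ).mul (by fun_prop)) (R := τ)
        fun x hx => by rw [hzero x hx, zero_mul]
    refine ⟨∫ x, deriv η (‖x - y‖ ^ 2 / τ ^ 2) * (-2 * ‖x - y‖ ^ 2 / τ ^ 3) * W x,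
      (hJ.const_mul (ρ ^ n / 2)).sub hWd |>.congr_deriv ?_, ?_⟩
    · congr 2
      have hη' : ∀ x : E n, deriv (fun t => η (t / τ ^ 2)) (‖x - y‖ ^ 2) =
          deriv η (‖x - y‖ ^ 2 / τ ^ 2) / τ ^ 2 := fun x => by
        have h1 : HasDerivAt (fun t : ℝ => t / τ ^ 2) (1 / τ ^ 2) (‖x - y‖ ^ 2) :=
          (hasDerivAt_id _).div_const _
        have h2 := ((hη.differentiable (by simp) (‖x - y‖ ^ 2 / τ ^ 2)).hasDerivAt.comp
          (‖x - y‖ ^ 2) h1).deriv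
        refine Eq.trans h2 ?_
        ring
      -- Stationarity for this profile expresses the derivative of the scaled cut-off energy through
      -- `A τ` alone.
      have hst := hu.integral_radial hG y (h := fun t => η (t / τ ^ 2))
        (hη.comp (contDiff_id.div_const _)) hτ fun t ht => h0 _ (by
          rwa [one_le_div (by positivity)])
      have hst' : ∀ x, ((n - 2) * η (‖x - y‖ ^ 2 / τ ^ 2) +
          2 * ‖x - y‖ ^ 2 * deriv (fun t => η (t / τ ^ 2)) (‖x - y‖ ^ 2)) * S x -
          4 * deriv (fun t => η (t / τ ^ 2)) (‖x - y‖ ^ 2) * W x =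
          ((n : ℝ) - 2) * (η (‖x - y‖ ^ 2 / τ ^ 2) * S x) -
          τ * (deriv η (‖x - y‖ ^ 2 / τ ^ 2) * (-2 * ‖x - y‖ ^ 2 / τ ^ 3) * S x) -
          4 / τ ^ 2 * (deriv η (‖x - y‖ ^ 2 / τ ^ 2) * W x) := fun x => by
        rw [hη']; field_simp; ring
      rw [integral_congr_ae (Eventually.of_forall hst')] at hst
      have i1 : Integrable fun x => ((n : ℝ) - 2) * (η (‖x - y‖ ^ 2 / τ ^ 2) * S x) -
          τ * (deriv η (‖x - y‖ ^ 2 / τ ^ 2) * (-2 * ‖x - y‖ ^ 2 / τ ^ 3) * S x) :=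
        (iS.const_mul _).sub ((iD S hS).const_mul _)
      rw [integral_sub i1 (iA.const_mul _), integral_sub (iS.const_mul _) ((iD S hS).const_mul _),
        integral_const_mul, integral_const_mul, integral_const_mul] at hst
      have e1 : τ ^ (2 - (n : ℤ) - 1) = τ ^ (-(n : ℤ) - 1) * τ ^ 2 := by
        rw [← zpow_natCast, ← zpow_add₀ hτ.ne']; congr 1; push_cast; ring
      have e2 : τ ^ (2 - (n : ℤ)) = τ ^ (-(n : ℤ) - 1) * τ ^ 3 := by
        rw [← zpow_natCast, ← zpow_add₀ hτ.ne']; congr 1; push_cast; ring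
      rw [e1, e2]
      change (n - 2) * cutoffIntegral η S y τ - τ * _ - 4 / τ ^ 2 * A τ = 0 at hst
      set D := ∫ x, deriv η (‖x - y‖ ^ 2 / τ ^ 2) * (-2 * ‖x - y‖ ^ 2 / τ ^ 3) * S x
      have h4 : 4 * A τ = τ ^ 2 * ((n - 2) * cutoffIntegral η S y τ - τ * D) := by
        field_simp at hst
        linarith
      push_cast
      linear_combination τ ^ (-(n : ℤ) - 1) * h4
    · rw [← integral_const_mul]
      -- The extra factor `|x - y|²/τ²` is at most one wherever `η'` is nonzero, and `η' ≤ 0`.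
      refine integral_mono (iD W hW) (iA.const_mul _) fun x => ?_
      by_cases hx : ‖x - y‖ ≤ τ
      · have h1 : ‖x - y‖ ^ 2 / τ ^ 2 ≤ 1 := by
          rw [div_le_one (by positivity)]; gcongr
        have h2 : 0 ≤ -deriv η (‖x - y‖ ^ 2 / τ ^ 2) * W x :=
          mul_nonneg (neg_nonneg.2 (hdnonpos _)) (sq_nonneg _)
        have h3 : deriv η (‖x - y‖ ^ 2 / τ ^ 2) * (-2 * ‖x - y‖ ^ 2 / τ ^ 3) * W x =
            2 / τ * (‖x - y‖ ^ 2 / τ ^ 2) * (-deriv η (‖x - y‖ ^ 2 / τ ^ 2) * W x) := by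
          field_simp
        have h4 : -2 / τ * (deriv η (‖x - y‖ ^ 2 / τ ^ 2) * W x) =
            2 / τ * 1 * (-deriv η (‖x - y‖ ^ 2 / τ ^ 2) * W x) := by ring
        change _ ≤ -2 / τ * (deriv η (‖x - y‖ ^ 2 / τ ^ 2) * W x)
        rw [h3, h4]
        gcongr
      · simp [hzero x (not_le.1 hx)]
  have hmono : MonotoneOn F (Icc σ ρ) := by
    refine monotoneOn_of_deriv_nonneg (convex_Icc σ ρ) ?_ ?_ ?_
    · intro τ hτ
      obtain ⟨k, hk, -⟩ := hder τ (hσ.trans_le hτ.1)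
      exact hk.continuousAt.continuousWithinAt
    · intro τ hτ
      rw [interior_Icc] at hτ
      obtain ⟨k, hk, -⟩ := hder τ (hσ.trans hτ.1)
      exact hk.differentiableAt.differentiableWithinAt
    · intro τ hτ
      rw [interior_Icc] at hτ
      have hτ0 := hσ.trans hτ.1
      obtain ⟨k, hk, hk'⟩ := hder τ hτ0
      rw [hk.deriv]
      have hA : A τ ≤ 0 := integral_nonpos fun x =>
        mul_nonpos_of_nonpos_of_nonneg (hdnonpos _) (sq_nonneg _)
      have hz : τ ^ (-(n : ℤ) - 1) = (τ ^ n)⁻¹ * τ⁻¹ := by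
        rw [zpow_sub₀ hτ0.ne', zpow_neg, zpow_natCast, zpow_one, div_eq_mul_inv]
      have h1 : -2 / τ * A τ ≤ ρ ^ n / 2 * (-4 * τ ^ (-(n : ℤ) - 1) * A τ) := by
        have h2 : ρ ^ n / 2 * (-4 * τ ^ (-(n : ℤ) - 1) * A τ) =
            (ρ ^ n * (τ ^ n)⁻¹) * (2 / τ * -A τ) := by
          rw [hz]; ring
        have h3 : 1 ≤ ρ ^ n * (τ ^ n)⁻¹ := by
          rw [← div_eq_mul_inv, one_le_div (by positivity)]
          exact pow_le_pow_left₀ hτ0.le hτ.2.le n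
        have h4 : 0 ≤ 2 / τ * -A τ := mul_nonneg (by positivity) (neg_nonneg.2 hA)
        rw [h2]
        have h5 : -2 / τ * A τ = 1 * (2 / τ * -A τ) := by ring
        rw [h5]
        exact mul_le_mul_of_nonneg_right h3 h4
      linarith
  have := hmono (left_mem_Icc.2 hσρ) (right_mem_Icc.2 hσρ) hσρ
  simp only [F] at this
  linarith

/-- Smooth cutoffs increasing to the indicator function of `(-∞, 1)`. -/
lemma tendsto_cutoffIntegral {f : E n → ℝ} {y : E n} (hfm : AEStronglyMeasurable f volume)
    (hf : ∀ R, IntegrableOn f (Metric.ball y R)) {ρ : ℝ} (hρ : 0 < ρ) :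
    Tendsto (fun k : ℕ => cutoffIntegral (fun t => Real.smoothTransition (k * (1 - t))) f y ρ)
      atTop (𝓝 (∫ x in Metric.ball y ρ, f x)) := by
  rw [← integral_indicator Metric.isOpen_ball.measurableSet]
  have hcases : ∀ x, x ∉ Metric.ball y ρ → 1 ≤ ‖x - y‖ ^ 2 / ρ ^ 2 := fun x hx => by
    rw [mem_ball_iff_norm, not_lt] at hx
    rw [one_le_div (by positivity)]
    gcongr
  have hz : ∀ (k : ℕ) (x : E n), x ∉ Metric.ball y ρ →
      Real.smoothTransition (k * (1 - ‖x - y‖ ^ 2 / ρ ^ 2)) = 0 := fun k x hx =>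
    Real.smoothTransition.zero_of_nonpos
      (mul_nonpos_of_nonneg_of_nonpos k.cast_nonneg (by linarith [hcases x hx]))
  refine tendsto_integral_of_dominated_convergence
    (fun x => (Metric.ball y ρ).indicator (fun x => |f x|) x) ?_ ?_ ?_ ?_
  · intro k
    refine AEStronglyMeasurable.mul (Continuous.aestronglyMeasurable ?_) hfm
    exact Real.smoothTransition.continuous.comp (by fun_prop)
  · rw [integrable_indicator_iff Metric.isOpen_ball.measurableSet]
    exact (hf ρ).abs
  · refine fun k => Eventually.of_forall fun x => ?_
    by_cases hx : x ∈ Metric.ball y ρ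
    · rw [indicator_of_mem hx, norm_mul, Real.norm_of_nonneg (Real.smoothTransition.nonneg _)]
      exact mul_le_of_le_one_left (abs_nonneg _) (Real.smoothTransition.le_one _)
    · rw [indicator_of_notMem hx]; simp only [hz k x hx]; simp
  · refine Eventually.of_forall fun x => ?_
    by_cases hx : x ∈ Metric.ball y ρ
    · rw [indicator_of_mem hx]
      refine tendsto_const_nhds.congr' ?_
      have h1 : 0 < 1 - ‖x - y‖ ^ 2 / ρ ^ 2 := by
        rw [mem_ball_iff_norm] at hx
        rw [sub_pos, div_lt_one (by positivity)]
        gcongr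
      -- From this index on the cutoff equals one at `x`.
      obtain ⟨k₀, hk₀⟩ := exists_nat_ge (1 / (1 - ‖x - y‖ ^ 2 / ρ ^ 2))
      filter_upwards [eventually_ge_atTop k₀] with k hk
      rw [Real.smoothTransition.one_of_one_le, one_mul]
      rw [← div_le_iff₀ h1]
      exact hk₀.trans (by exact_mod_cast hk)
    · rw [indicator_of_notMem hx]
      refine tendsto_const_nhds.congr fun k => ?_
      simp only [hz k x hx, zero_mul]

/-- The monotonicity inequality: the increase of the scaled energy controls the radial
derivative. -/
theorem IsEnergyMinimizing.monotonicity {N : Set (E p)} {u : E n → E p}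
    (hu : IsEnergyMinimizing univ N u) {G : Fin n → E n → E p} (hG : IsGlobalGradient u G)
    (y : E n) {σ ρ : ℝ} (hσ : 0 < σ) (hσρ : σ ≤ ρ) :
    (∫ x in Metric.ball y ρ, ‖radialDeriv y G x‖ ^ 2) -
        ∫ x in Metric.ball y σ, ‖radialDeriv y G x‖ ^ 2 ≤
      ρ ^ n / 2 * (scaledEnergy u y ρ - scaledEnergy u y σ) := by
  have hρ := hσ.trans_le hσρ
  have hW := fun {τ : ℝ} (hτ : 0 < τ) =>
    tendsto_cutoffIntegral ((hG.aestronglyMeasurable_radialDeriv y).norm.pow 2)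
      (hG.integrableOn_radialDeriv y) hτ
  have hS := fun {τ : ℝ} (hτ : 0 < τ) =>
    tendsto_cutoffIntegral hG.aestronglyMeasurable_sq (hG.integrableOn_sq y) hτ
  simp only [scaledEnergy, hG.energy_ball]
  refine le_of_tendsto_of_tendsto' ((hW hρ).sub (hW hσ))
    ((((hS hρ).const_mul _).sub ((hS hσ).const_mul _)).const_mul (ρ ^ n / 2)) fun k => ?_
  refine hu.cutoffIntegral_sub_le hG y ?_ ?_ ?_ hσ hσρ
  · exact Real.smoothTransition.contDiff.comp (contDiff_const.mul (contDiff_const.sub contDiff_id))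
  · intro t ht
    exact Real.smoothTransition.zero_of_nonpos
      (mul_nonpos_of_nonneg_of_nonpos k.cast_nonneg (by linarith))
  · intro s t hst
    exact Real.smoothTransition.monotone
      (mul_le_mul_of_nonneg_left (by linarith) k.cast_nonneg)

/-! ### Density and the case of constant scaled energy -/

lemma scaledEnergy_nonneg (u : E n → E p) (y : E n) {ρ : ℝ} (hρ : 0 ≤ ρ) :
    0 ≤ scaledEnergy u y ρ :=
  mul_nonneg (zpow_nonneg hρ _)
    (integral_nonneg fun _ => Finset.sum_nonneg fun _ _ => sq_nonneg _)

lemma IsEnergyMinimizing.monotoneOn_scaledEnergy {N : Set (E p)} {u : E n → E p}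
    (hu : IsEnergyMinimizing univ N u) (y : E n) : MonotoneOn (scaledEnergy u y) (Ioi 0) := by
  intro σ hσ ρ hρ hσρ
  obtain ⟨G, hG⟩ := hu.exists_isGlobalGradient
  have h1 := hu.monotonicity hG y hσ hσρ
  have h2 : ∫ x in Metric.ball y σ, ‖radialDeriv y G x‖ ^ 2 ≤
      ∫ x in Metric.ball y ρ, ‖radialDeriv y G x‖ ^ 2 :=
    setIntegral_mono_set (hG.integrableOn_radialDeriv y ρ)
      (Eventually.of_forall fun x => sq_nonneg _)
      (Metric.ball_subset_ball hσρ).eventuallyLE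
  have h3 : 0 < ρ ^ n / 2 := by have : 0 < ρ := hρ; positivity
  have h4 : 0 ≤ ρ ^ n / 2 * (scaledEnergy u y ρ - scaledEnergy u y σ) := by linarith
  exact sub_nonneg.1 (nonneg_of_mul_nonneg_right h4 h3)

/-- The density exists everywhere. -/
theorem IsEnergyMinimizing.tendsto_scaledEnergy {N : Set (E p)} {u : E n → E p}
    (hu : IsEnergyMinimizing univ N u) (y : E n) :
    Tendsto (scaledEnergy u y) (𝓝[>] 0) (𝓝 (density u y)) := by
  refine tendsto_nhds_limUnder ⟨_, (hu.monotoneOn_scaledEnergy y).tendsto_nhdsGT ?_⟩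
  exact ⟨0, by rintro _ ⟨ρ, hρ, rfl⟩; exact scaledEnergy_nonneg u y (le_of_lt hρ)⟩

lemma IsEnergyMinimizing.density_le_scaledEnergy {N : Set (E p)} {u : E n → E p}
    (hu : IsEnergyMinimizing univ N u) (y : E n) {ρ : ℝ} (hρ : 0 < ρ) :
    density u y ≤ scaledEnergy u y ρ := by
  refine le_of_tendsto (hu.tendsto_scaledEnergy y) ?_
  filter_upwards [Ioo_mem_nhdsGT hρ] with σ hσ
  exact hu.monotoneOn_scaledEnergy y hσ.1 hρ hσ.2.le

/-- Where the scaled energy is constant, the radial derivative vanishes. -/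
lemma IsEnergyMinimizing.radialDeriv_eq_zero {N : Set (E p)} {u : E n → E p}
    (hu : IsEnergyMinimizing univ N u) {G : Fin n → E n → E p} (hG : IsGlobalGradient u G)
    {y : E n} {Q : ℝ} (hQ : ∀ ρ, 0 < ρ → scaledEnergy u y ρ = Q) :
    ∀ᵐ x, radialDeriv y G x = 0 := by
  have hball : ∀ ρ : ℝ, 0 < ρ → ∀ᵐ x, x ∈ Metric.ball y ρ → radialDeriv y G x = 0 := by
    intro ρ hρ
    -- Constant scaled energy leaves nothing in the annulus between `σ` and `ρ`, and the part in the
    -- small ball is `O(σ²)` since `|x - y| < σ` there.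
    have hbound : ∀ σ, 0 < σ → σ ≤ ρ → ∫ x in Metric.ball y ρ, ‖radialDeriv y G x‖ ^ 2 ≤
        σ ^ 2 * ∫ x in Metric.ball y ρ, ∑ i, ‖G i x‖ ^ 2 := by
      intro σ hσ hσρ
      have h1 := hu.monotonicity hG y hσ hσρ
      rw [hQ ρ hρ, hQ σ hσ, sub_self, mul_zero, sub_nonpos] at h1
      refine h1.trans ?_
      calc ∫ x in Metric.ball y σ, ‖radialDeriv y G x‖ ^ 2
          ≤ ∫ x in Metric.ball y σ, σ ^ 2 * ∑ i, ‖G i x‖ ^ 2 := by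
            refine setIntegral_mono_on (hG.integrableOn_radialDeriv y σ)
              ((hG.integrableOn_sq y σ).const_mul _) Metric.isOpen_ball.measurableSet
              fun x hx => (sq_norm_radialDeriv_le y G x).trans ?_
            rw [mem_ball_iff_norm] at hx
            refine mul_le_mul_of_nonneg_right ?_ (Finset.sum_nonneg fun i _ => sq_nonneg _)
            gcongr
        _ ≤ _ := by
            rw [integral_const_mul]
            refine mul_le_mul_of_nonneg_left ?_ (sq_nonneg _)
            exact setIntegral_mono_set (hG.integrableOn_sq y ρ)
              (Eventually.of_forall fun x => Finset.sum_nonneg fun i _ => sq_nonneg _)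
              (Metric.ball_subset_ball hσρ).eventuallyLE
    have hle : ∫ x in Metric.ball y ρ, ‖radialDeriv y G x‖ ^ 2 ≤ 0 := by
      have hlim : Tendsto (fun σ : ℝ => σ ^ 2 * ∫ x in Metric.ball y ρ, ∑ i, ‖G i x‖ ^ 2)
          (𝓝[>] 0) (𝓝 0) := by
        have h : Tendsto (fun σ : ℝ => σ ^ 2 * ∫ x in Metric.ball y ρ, ∑ i, ‖G i x‖ ^ 2)
            (𝓝 0) (𝓝 (0 ^ 2 * ∫ x in Metric.ball y ρ, ∑ i, ‖G i x‖ ^ 2)) :=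
          (tendsto_id.pow 2).mul_const _
        rw [zero_pow two_ne_zero, zero_mul] at h
        exact h.mono_left nhdsWithin_le_nhds
      refine ge_of_tendsto hlim ?_
      filter_upwards [Ioo_mem_nhdsGT hρ] with σ hσ using hbound σ hσ.1 hσ.2.le
    have hzero := le_antisymm hle (integral_nonneg fun x => sq_nonneg _)
    rw [setIntegral_eq_zero_iff_of_nonneg_ae (Eventually.of_forall fun x => sq_nonneg _)
      (hG.integrableOn_radialDeriv y ρ)] at hzero
    rw [Filter.EventuallyEq, ae_restrict_iff' Metric.isOpen_ball.measurableSet] at hzero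
    filter_upwards [hzero] with x hx hxb
    simpa using hx hxb
  have hall := ae_all_iff.2 fun k : ℕ => hball ((k : ℝ) + 1) (by positivity)
  filter_upwards [hall] with x hx
  refine hx ⌈‖x - y‖⌉₊ ?_
  rw [mem_ball_iff_norm]
  exact (Nat.le_ceil _).trans_lt (lt_add_one _)

/-! ### Affine rescaling and homogeneous maps -/

lemma IsDiffeo.symm {Ψ Θ : E n → E n} (h : IsDiffeo Ψ Θ) : IsDiffeo Θ Ψ where
  contDiff := h.contDiff_inv
  contDiff_inv := h.contDiff
  left_inv := h.right_inv
  right_inv := h.left_inv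
  det_pos z := by
    have h1 : (fderiv ℝ Ψ (Θ z)) * (fderiv ℝ Θ z) = 1 := by
      ext v : 1
      have := h.fderiv_inv_apply (Θ z) v
      rwa [h.right_inv] at this
    have h2 : (fderiv ℝ Ψ (Θ z)).det * (fderiv ℝ Θ z).det = 1 := by
      have h3 := LinearMap.det_comp (fderiv ℝ Ψ (Θ z) : E n →ₗ[ℝ] E n)
        (fderiv ℝ Θ z : E n →ₗ[ℝ] E n)
      rw [ContinuousLinearMap.det, ContinuousLinearMap.det, ← h3]
      have h4 : (fderiv ℝ Ψ (Θ z) : E n →ₗ[ℝ] E n) ∘ₗ (fderiv ℝ Θ z : E n →ₗ[ℝ] E n) =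
          LinearMap.id := by
        ext1 v
        exact congrArg (fun L : E n →L[ℝ] E n => L v) h1
      rw [h4, LinearMap.det_id]
    exact (pos_iff_pos_of_mul_pos (by rw [h2]; exact one_pos)).1 (h.det_pos _)

lemma fderiv_affine (c : ℝ) (y x : E n) :
    fderiv ℝ (fun z : E n => c • z + y) x = c • ContinuousLinearMap.id ℝ (E n) :=
  (((hasFDerivAt_id x).const_smul c).add_const y).fderiv

lemma det_smul_id (c : ℝ) : (c • ContinuousLinearMap.id ℝ (E n)).det = c ^ n := by
  rw [ContinuousLinearMap.det]
  have : ((c • ContinuousLinearMap.id ℝ (E n) : E n →L[ℝ] E n) : E n →ₗ[ℝ] E n) =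
    c • LinearMap.id := rfl
  rw [this, LinearMap.det_smul]
  simp

lemma isDiffeo_affine {c : ℝ} (hc : 0 < c) (y : E n) :
    IsDiffeo (fun z : E n => c • z + y) (fun z => c⁻¹ • (z - y)) where
  contDiff := (contDiff_id.const_smul c).add contDiff_const
  contDiff_inv := (contDiff_id.sub contDiff_const).const_smul c⁻¹
  left_inv x := by simp [smul_smul, hc.ne']
  right_inv z := by simp [smul_smul, hc.ne']
  det_pos x := by rw [fderiv_affine, det_smul_id]; positivity

lemma setIntegral_affine_image {V : Type*} [NormedAddCommGroup V] [NormedSpace ℝ V] {c : ℝ}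
    (hc : 0 < c) (y : E n) {s : Set (E n)} (hs : MeasurableSet s) (F : E n → V) :
    ∫ z in (fun z : E n => c • z + y) '' s, F z = c ^ n • ∫ x in s, F (c • x + y) := by
  rw [(isDiffeo_affine hc y).setIntegral_image hs]
  simp only [fderiv_affine, det_smul_id, integral_smul]

lemma affine_image_ball {c : ℝ} (hc : 0 < c) (y x : E n) (r : ℝ) :
    (fun z : E n => c • z + y) '' Metric.ball x r = Metric.ball (c • x + y) (c * r) := by
  ext z
  simp only [mem_image, mem_ball_iff_norm]
  constructor
  · rintro ⟨w, hw, rfl⟩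
    rw [add_sub_add_right_eq_sub, ← smul_sub, norm_smul, Real.norm_of_nonneg hc.le]
    gcongr
  · intro hz
    have hw := (isDiffeo_affine hc y).right_inv z
    refine ⟨c⁻¹ • (z - y), ?_, hw⟩
    rw [← hw, add_sub_add_right_eq_sub, ← smul_sub, norm_smul, Real.norm_of_nonneg hc.le] at hz
    exact lt_of_mul_lt_mul_left hz hc.le

lemma affine_image_closedBall {c : ℝ} (hc : 0 < c) (y x : E n) (r : ℝ) :
    (fun z : E n => c • z + y) '' Metric.closedBall x r =
      Metric.closedBall (c • x + y) (c * r) := by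
  ext z
  simp only [mem_image, mem_closedBall_iff_norm]
  constructor
  · rintro ⟨w, hw, rfl⟩
    rw [add_sub_add_right_eq_sub, ← smul_sub, norm_smul, Real.norm_of_nonneg hc.le]
    gcongr
  · intro hz
    have hw := (isDiffeo_affine hc y).right_inv z
    refine ⟨c⁻¹ • (z - y), ?_, hw⟩
    rw [← hw, add_sub_add_right_eq_sub, ← smul_sub, norm_smul, Real.norm_of_nonneg hc.le] at hz
    exact le_of_mul_le_mul_left hz hc

/-- The scaled energy of a map that is invariant under a dilation and translation. -/
lemma IsGlobalGradient.scaledEnergy_affine {u : E n → E p} {G : Fin n → E n → E p}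
    (hG : IsGlobalGradient u G) {c : ℝ} (hc : 0 < c) {y : E n}
    (hinv : ∀ᵐ x, u (c • x + y) = u x) (x : E n) {r : ℝ} :
    scaledEnergy u (c • x + y) (c * r) = scaledEnergy u x r := by
  -- The chain rule gives `u` a second gradient, and uniqueness turns the invariance of `u` into one
  -- of `G`.
  have hG' := (hG.comp_diffeo (isDiffeo_affine hc y).symm).congr hinv
  have hae : ∀ᵐ z, ∀ i, G i z = c • G i (c • z + y) := by
    refine eventually_all.2 fun i => ?_
    filter_upwards [hG.ae_eq hG' i] with z hz
    rw [hz]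
    simp only [compGradient, fderiv_affine, FunLike.coe_smul, Pi.smul_apply,
      ContinuousLinearMap.coe_id', id_eq, PiLp.smul_apply, stdVec_apply, smul_eq_mul]
    simp
  have hE : ∫ z in Metric.ball x r, ∑ i, ‖G i z‖ ^ 2 =
      c ^ 2 * ∫ z in Metric.ball x r, ∑ i, ‖G i (c • z + y)‖ ^ 2 := by
    rw [← integral_const_mul]
    refine integral_congr_ae (ae_restrict_of_ae ?_)
    filter_upwards [hae] with z hz
    rw [Finset.mul_sum]
    refine Finset.sum_congr rfl fun i _ => ?_
    rw [hz i, norm_smul, mul_pow, Real.norm_eq_abs, sq_abs]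
  rw [scaledEnergy, scaledEnergy, hG.energy_ball, hG.energy_ball, ← affine_image_ball hc,
    setIntegral_affine_image hc y Metric.isOpen_ball.measurableSet, hE, mul_zpow, smul_eq_mul]
  -- Scaling of the prefactor and of volume together balances the `c²` from the squared gradient.
  have : c ^ (2 - (n : ℤ)) * c ^ n = c ^ 2 := by
    rw [← zpow_natCast, ← zpow_add₀ hc.ne', sub_add_cancel]; norm_cast
  rw [← this]; ring

/-- A homogeneous map has constant scaled energy at the origin. -/
lemma IsEnergyMinimizing.scaledEnergy_zero_eq {N : Set (E p)} {u : E n → E p}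
    (hu : IsEnergyMinimizing univ N u) (hh : IsHomogeneousZero u) {ρ : ℝ} (hρ : 0 < ρ) :
    scaledEnergy u 0 ρ = density u 0 := by
  obtain ⟨G, hG⟩ := hu.exists_isGlobalGradient
  refine tendsto_nhds_unique (tendsto_const_nhds.congr' ?_) (hu.tendsto_scaledEnergy 0)
  filter_upwards [self_mem_nhdsWithin] with r hr
  have hr0 : 0 < r := hr
  have hc : 0 < ρ / r := by positivity
  have := hG.scaledEnergy_affine hc (y := 0) (by simpa using hh _ hc) 0 (r := r)
  rw [smul_zero, add_zero, div_mul_cancel₀ _ hr0.ne'] at this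
  exact this

/-- By monotonicity the radius may be enlarged to any `r ≥ ρ`. As `B_r(y) ⊆ B_{r+|y|}(0)`, the price
is the factor `(r/(r+|y|))^(2-n)`, which tends to one. -/
lemma IsEnergyMinimizing.scaledEnergy_le_density_zero {N : Set (E p)} {u : E n → E p}
    (hu : IsEnergyMinimizing univ N u) (hh : IsHomogeneousZero u) (y : E n) {ρ : ℝ} (hρ : 0 < ρ) :
    scaledEnergy u y ρ ≤ density u 0 := by
  obtain ⟨G, hG⟩ := hu.exists_isGlobalGradient
  have hlim : Tendsto (fun r : ℝ => (1 - ‖y‖ / (r + ‖y‖)) ^ (2 - (n : ℤ)) * density u 0) atTop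
      (𝓝 (density u 0)) := by
    have h1 : Tendsto (fun r : ℝ => 1 - ‖y‖ / (r + ‖y‖)) atTop (𝓝 (1 - 0)) :=
      tendsto_const_nhds.sub (tendsto_const_nhds.div_atTop
        (tendsto_atTop_add_const_right _ _ tendsto_id))
    have h2 := (h1.zpow₀ (2 - (n : ℤ)) (Or.inl (by norm_num))).mul_const (density u 0)
    simpa using h2
  refine ge_of_tendsto hlim ?_
  filter_upwards [eventually_ge_atTop ρ] with r hr
  have hr0 : 0 < r := hρ.trans_le hr
  have hs0 : 0 < r + ‖y‖ := by positivity
  refine (hu.monotoneOn_scaledEnergy y hρ hr0 hr).trans ?_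
  rw [← hu.scaledEnergy_zero_eq hh hs0, scaledEnergy, scaledEnergy, ← mul_assoc, ← mul_zpow]
  have e1 : (1 - ‖y‖ / (r + ‖y‖)) * (r + ‖y‖) = r := by field_simp; ring
  rw [e1, hG.energy_ball, hG.energy_ball]
  refine mul_le_mul_of_nonneg_left ?_ (zpow_nonneg hr0.le _)
  exact setIntegral_mono_set (hG.integrableOn_sq 0 _)
    (Eventually.of_forall fun x => Finset.sum_nonneg fun i _ => sq_nonneg _)
    (Metric.ball_subset_ball' (by simp)).eventuallyLE

/-! ### Translation invariance and the set of maximal density -/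

lemma apply_eq_sum_stdVec (L : E n →L[ℝ] ℝ) (v : E n) : L v = ∑ i, v i * L (stdVec i) := by
  conv_lhs => rw [eq_sum_stdVec v]
  simp

/-- A map whose derivative in the direction `y` vanishes is invariant under translation by `y`. -/
lemma IsGlobalGradient.ae_translate_eq {u : E n → E p} {G : Fin n → E n → E p}
    (hG : IsGlobalGradient u G) {y : E n} (h0 : ∀ᵐ x, ∑ i, y i • G i x = 0) :
    ∀ᵐ x, u (x + y) = u x := by
  have hloc : LocallyIntegrable (fun x => u (x + y)) := by
    have := (hG.comp_diffeo (isDiffeo_affine one_pos y).symm).locallyIntegrable_fun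
    simpa using this
  refine ae_eq_of_integral_contDiff_smul_eq hloc hG.locallyIntegrable_fun fun ζ hζ hc => ?_
  -- The translation is moved onto the test function, where it can be differentiated in `t`; the
  -- claim is `f 1 = f 0`.
  let f : ℝ → E p := fun t => ∫ x, ζ (x - t • y) • u x
  have hdc : Continuous (fderiv ℝ ζ) := hζ.continuous_fderiv (by simp)
  obtain ⟨C, hC⟩ := hdc.bounded_above_of_compact_support (hc.fderiv ℝ)
  obtain ⟨R, hR⟩ := hc.isCompact.isBounded.subset_ball (0 : E n)
  have htrans : ∀ t : ℝ, ContDiff ℝ ∞ (fun x => ζ (x - t • y)) ∧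
      HasCompactSupport (fun x => ζ (x - t • y)) := fun t =>
    ⟨hζ.comp (contDiff_id.sub contDiff_const), hc.comp_homeomorph (Homeomorph.subRight (t • y))⟩
  have hfd : ∀ (t : ℝ) (x v : E n), fderiv ℝ (fun x => ζ (x - t • y)) x v =
      fderiv ℝ ζ (x - t • y) v := fun t x v => by
    rw [fderiv_comp_sub]
  have hder : ∀ t, HasDerivAt f 0 t := by
    intro t
    have hd : HasDerivAt f (∫ x, (-(fderiv ℝ ζ (x - t • y) y)) • u x) t := by
      refine (hasDerivAt_integral_of_dominated_loc_of_deriv_le (Metric.ball_mem_nhds t one_pos)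
        (F := fun t x => ζ (x - t • y) • u x)
        (F' := fun t x => (-(fderiv ℝ ζ (x - t • y) y)) • u x)
        -- This ball contains the supports of all translates with `|s - t| < 1`.
        (bound := (Metric.ball 0 (R + (|t| + 1) * ‖y‖)).indicator fun x => C * ‖y‖ * ‖u x‖)
        ?_ ?_ ?_ ?_ ?_ ?_).2
      · exact Eventually.of_forall fun s => (htrans s).1.continuous.aestronglyMeasurable.smul
          hG.locallyIntegrable_fun.aestronglyMeasurable
      · exact hG.integrable_smul_fun (htrans t).1.continuous (htrans t).2
      · have hk : Continuous fun x => -(fderiv ℝ ζ (x - t • y) y) :=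
          ((hdc.comp (continuous_id.sub continuous_const)).clm_apply continuous_const).neg
        exact hk.aestronglyMeasurable.smul hG.locallyIntegrable_fun.aestronglyMeasurable
      · refine Eventually.of_forall fun x s hs => ?_
        rw [Metric.mem_ball, Real.dist_eq] at hs
        by_cases hx : x ∈ Metric.ball (0 : E n) (R + (|t| + 1) * ‖y‖)
        · rw [indicator_of_mem hx, norm_smul, norm_neg]
          exact mul_le_mul_of_nonneg_right (((fderiv ℝ ζ _).le_opNorm y).trans
            (mul_le_mul_of_nonneg_right (hC _) (norm_nonneg _))) (norm_nonneg _)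
        · have hx' : x - s • y ∉ tsupport ζ := fun hmem => hx (by
            have h1 := hR hmem
            rw [mem_ball_zero_iff] at h1 ⊢
            have h2 : ‖x‖ ≤ ‖x - s • y‖ + ‖s • y‖ := by
              simpa using norm_add_le (x - s • y) (s • y)
            rw [norm_smul, Real.norm_eq_abs] at h2
            have h3 : |s| ≤ |t| + 1 := by
              have := abs_sub_abs_le_abs_sub s t
              linarith
            have h4 := mul_le_mul_of_nonneg_right h3 (norm_nonneg y)
            linarith)
          rw [fderiv_apply_eq_zero_of_notMem_tsupport ζ _ hx', indicator_of_notMem hx]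
          simp
      · rw [integrable_indicator_iff Metric.isOpen_ball.measurableSet]
        have h1 : IntegrableOn u (Metric.ball 0 (R + (|t| + 1) * ‖y‖)) :=
          (hG.locallyIntegrable_fun.integrableOn_isCompact (isCompact_closedBall _ _)).mono_set
            Metric.ball_subset_closedBall
        exact h1.norm.const_mul _
      · refine Eventually.of_forall fun x s _ => ?_
        have h1 : HasDerivAt (fun s : ℝ => x - s • y) (-y) s := by
          simpa using ((hasDerivAt_id s).smul_const y).const_sub x
        have h2 := (hζ.differentiable (by simp) (x - s • y)).hasFDerivAt.comp_hasDerivAt s h1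
        have h3 := h2.smul_const (u x)
        rw [map_neg] at h3
        exact h3
    convert hd using 1
    -- Splitting `y` along the basis lets each partial derivative be shifted to `u`, which leaves `∑
    -- yᵢ Dᵢu = 0`.
    have e1 : ∀ x, (-(fderiv ℝ ζ (x - t • y) y)) • u x =
        ∑ i, -(y i • (fderiv ℝ (fun x => ζ (x - t • y)) x (stdVec i) • u x)) := by
      intro x
      simp only [apply_eq_sum_stdVec _ y, hfd, smul_smul, Finset.sum_neg_distrib, neg_smul,
        Finset.sum_smul]
    have i1 : ∀ i, Integrable fun x => fderiv ℝ (fun x => ζ (x - t • y)) x (stdVec i) • u x :=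
      fun i => hG.integrable_smul_fun
        (((htrans t).1.continuous_fderiv (by simp)).clm_apply continuous_const)
        ((htrans t).2.fderiv_apply ℝ _)
    simp only [e1]
    have i2 : ∀ i, Integrable fun x =>
        -(y i • (fderiv ℝ (fun x => ζ (x - t • y)) x (stdVec i) • u x)) :=
      fun i => ((i1 i).smul (y i)).neg
    have i3 : ∀ i, Integrable fun x => y i • (ζ (x - t • y) • G i x) := fun i =>
      (hG.integrable_smul (htrans t).1.continuous (htrans t).2 i).smul (y i)
    rw [integral_finsetSum _ fun i _ => i2 i]
    have e2 : ∀ i, ∫ x, -(y i • (fderiv ℝ (fun x => ζ (x - t • y)) x (stdVec i) • u x)) =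
        ∫ x, y i • (ζ (x - t • y) • G i x) := fun i => by
      rw [integral_neg,
        MeasureTheory.integral_smul (y i) fun x =>
          fderiv ℝ (fun x => ζ (x - t • y)) x (stdVec i) • u x,
        MeasureTheory.integral_smul (y i) fun x => ζ (x - t • y) • G i x,
        hG.integral_smul _ (htrans t).1 (htrans t).2 i, smul_neg]
    simp only [e2]
    rw [← integral_finsetSum _ fun i _ => i3 i]
    refine (integral_eq_zero_of_ae ?_).symm
    filter_upwards [h0] with x hx
    simp only [smul_comm _ (ζ (x - t • y)), ← Finset.smul_sum, hx, smul_zero, Pi.zero_apply]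
  have hconst := is_const_of_deriv_eq_zero (fun t => (hder t).differentiableAt)
    (fun t => (hder t).deriv) 1 0
  simp only [f, one_smul, zero_smul, sub_zero] at hconst
  rw [← hconst, ← integral_add_right_eq_self (fun x => ζ (x - y) • u x) y]
  simp

/-- The set of maximal density of a homogeneous minimizing map consists of its periods. -/
theorem IsEnergyMinimizing.mem_maxDensitySet_iff {N : Set (E p)} {u : E n → E p}
    (hu : IsEnergyMinimizing univ N u) (hh : IsHomogeneousZero u) (y : E n) :
    y ∈ maxDensitySet u ↔ ∀ᵐ x, u (x + y) = u x := by
  obtain ⟨G, hG⟩ := hu.exists_isGlobalGradient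
  constructor
  · intro hy
    have hy' : density u y = density u 0 := hy
    -- The scaled energy at `y` is pinched between `Θ(y)` and `Θ(0)`, which agree.
    have h1 := hu.radialDeriv_eq_zero hG (y := y) fun ρ hρ =>
      le_antisymm (hu.scaledEnergy_le_density_zero hh y hρ)
        (hy' ▸ hu.density_le_scaledEnergy y hρ)
    have h2 := hu.radialDeriv_eq_zero hG (y := 0) fun ρ hρ => hu.scaledEnergy_zero_eq hh hρ
    refine hG.ae_translate_eq ?_
    filter_upwards [h1, h2] with x hx1 hx2
    have : ∑ i, y i • G i x = radialDeriv 0 G x - radialDeriv y G x := by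
      simp only [radialDeriv, ← Finset.sum_sub_distrib, ← sub_smul]
      refine Finset.sum_congr rfl fun i _ => ?_
      simp
    rw [this, hx1, hx2, sub_zero]
  · intro hy
    refine tendsto_nhds_unique (hu.tendsto_scaledEnergy y) ?_
    refine (hu.tendsto_scaledEnergy 0).congr fun r => ?_
    have := hG.scaledEnergy_affine one_pos (y := y) (by simpa using hy) 0 (r := r)
    simpa using this.symm

/-! ### The invariant representative -/

lemma setAverage_affine {u : E n → E p} {c : ℝ} (hc : 0 < c) {y : E n}
    (hinv : ∀ᵐ x, u (c • x + y) = u x) (x : E n) (r : ℝ) :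
    ⨍ z in Metric.closedBall (c • x + y) (c * r), u z = ⨍ z in Metric.closedBall x r, u z := by
  have hm : MeasurableSet (Metric.closedBall x r) := measurableSet_closedBall
  have h1 := setIntegral_affine_image hc y hm u
  have h2 := setIntegral_affine_image hc y hm (fun _ => (1 : ℝ))
  rw [integral_congr_ae (ae_restrict_of_ae hinv)] at h1
  rw [setIntegral_const, setIntegral_const] at h2
  simp only [smul_eq_mul, mul_one] at h2
  rw [setAverage_eq, setAverage_eq, ← affine_image_closedBall hc, h1, h2, mul_inv, smul_smul]
  congr 1
  have : c ^ n ≠ 0 := by positivity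
  field_simp

lemma map_mul_left_nhdsGT_zero {c : ℝ} (hc : 0 < c) :
    map (fun r : ℝ => c * r) (𝓝[>] 0) = 𝓝[>] 0 := by
  have h := (Homeomorph.mulLeft₀ c hc.ne').isInducing.map_nhdsWithin_eq (Ioi 0) 0
  simp only [Homeomorph.coe_mulLeft₀, mul_zero] at h
  rw [h]
  congr 1
  ext z
  simp only [mem_image, mem_Ioi]
  exact ⟨by rintro ⟨w, hw, rfl⟩; positivity,
    fun hz => ⟨z / c, by positivity, by field_simp⟩⟩

/-- A precise representative, invariant under all dilations and translations under which the
map is invariant almost everywhere. -/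
lemma exists_invariant_representative {u : E n → E p} (hu : LocallyIntegrable u)
    {N : Set (E p)} (hN : ∀ᵐ x, u x ∈ N) :
    ∃ ψ : E n → E p, ψ =ᵐ[volume] u ∧ (∀ x, ψ x ∈ N) ∧
      ∀ (c : ℝ) (y : E n), 0 < c → (∀ᵐ x, u (c • x + y) = u x) →
        ∀ x, ψ (c • x + y) = ψ x := by
  classical
  obtain ⟨x₀, hx₀⟩ := hN.exists
  let a : E n → E p := fun x => limUnder (𝓝[>] 0) fun r => ⨍ z in Metric.closedBall x r, u z
  -- The constant fallback forces values in `N` without breaking any symmetry, since the test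
  -- depends on `a x` only.
  refine ⟨fun x => if a x ∈ N then a x else u x₀, ?_, fun x => ?_, fun c y hc hinv x => ?_⟩
  · filter_upwards [IsUnifLocDoublingMeasure.ae_tendsto_average volume hu 1, hN] with x hx hxN
    have h1 : Tendsto (fun r => ⨍ z in Metric.closedBall x r, u z) (𝓝[>] 0) (𝓝 (u x)) := by
      refine hx (fun _ => x) (fun r => r) tendsto_id ?_
      filter_upwards [self_mem_nhdsWithin] with r hr
      exact Metric.mem_closedBall_self (by rw [one_mul]; exact le_of_lt hr)
    have h2 : a x = u x := h1.limUnder_eq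
    rw [h2, if_pos hxN]
  · dsimp only
    split_ifs with h
    · exact h
    · exact hx₀
  · have h : a (c • x + y) = a x := by
      simp only [a, limUnder]
      -- After rescaling the radius, both limits are taken along the same filter, so they agree even
      -- where the averages do not converge.
      conv_lhs => rw [← map_mul_left_nhdsGT_zero hc, map_map]
      congr 2
      ext1 r
      exact setAverage_affine hc hinv x r
    simp only [h]

/-- `u(x + cy) = u(x/c + y) = u(x/c) = u(x)`, where each exceptional null set is pulled back by an
affine map. -/
lemma IsHomogeneousZero.ae_translate_smul {u : E n → E p} (hh : IsHomogeneousZero u) {y : E n}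
    (hy : ∀ᵐ x, u (x + y) = u x) {c : ℝ} (hc : 0 < c) : ∀ᵐ x, u (x + c • y) = u x := by
  have hd := (isDiffeo_affine hc (0 : E n)).quasiMeasurePreserving_inv
  filter_upwards [hd.ae hy, hd.ae (hh c hc),
    (hd.comp (isDiffeo_affine one_pos (-(c • y))).quasiMeasurePreserving_inv).ae (hh c hc)]
    with x h1 h2 h3
  simp only [sub_zero, Function.comp_apply, inv_one, one_smul, sub_neg_eq_add, smul_smul,
    mul_inv_cancel₀ hc.ne'] at h1 h2 h3
  rw [h3, smul_add, smul_smul, inv_mul_cancel₀ hc.ne', one_smul, h1, ← h2]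

end EnergyMin

/-! ### The linear structure and the conclusion -/

/-- Let `N = range ι ⊆ ℝᵖ` be a smoothly embedded compact manifold without boundary (with
the Riemannian metric induced by `ℝᵖ`) and `φ : ℝⁿ → N`, `n ≥ 2`, an energy minimizing map
that is homogeneous of degree zero. Then the limit that defines `Θ_φ` exists everywhere,
`S(φ)` is a linear subspace, and `φ(x + y) = φ(x)` for `x ∈ ℝⁿ`, `y ∈ S(φ)`: for each
`y ∈ S(φ)` at almost every `x`, and for all `x`, `y` at once if the representative of the
a.e. class of `φ` is chosen suitably. -/
theorem theorem5 {n p d : ℕ} (hn : 2 ≤ n)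
    {M : Type*} [TopologicalSpace M] [ChartedSpace (EuclideanSpace ℝ (Fin d)) M]
    [IsManifold (𝓡 d) ∞ M] [CompactSpace M]
    (ι : M → EnergyMin.E p) (hι : Manifold.IsSmoothEmbedding (𝓡 d) 𝓘(ℝ, EnergyMin.E p) ∞ ι)
    (φ : EnergyMin.E n → EnergyMin.E p)
    (hmin : EnergyMin.IsEnergyMinimizing univ (range ι) φ)
    (hhom : EnergyMin.IsHomogeneousZero φ) :
    (∀ y, Tendsto (EnergyMin.scaledEnergy φ y) (𝓝[>] 0) (𝓝 (EnergyMin.density φ y))) ∧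
    (∃ V : Submodule ℝ (EnergyMin.E n),
      (V : Set (EnergyMin.E n)) = EnergyMin.maxDensitySet φ) ∧
    (∀ y ∈ EnergyMin.maxDensitySet φ, ∀ᵐ x, φ (x + y) = φ x) ∧
    (∃ ψ : EnergyMin.E n → EnergyMin.E p, ψ =ᵐ[volume] φ ∧ (∀ x, ψ x ∈ range ι) ∧
      (∀ c : ℝ, 0 < c → ∀ x, ψ (c • x) = ψ x) ∧
      ∀ x, ∀ y ∈ EnergyMin.maxDensitySet φ, ψ (x + y) = ψ x) := by
  have hmem := hmin.mem_maxDensitySet_iff hhom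
  obtain ⟨G, hG⟩ := hmin.exists_isGlobalGradient
  refine ⟨hmin.tendsto_scaledEnergy, ?_, fun y hy => (hmem y).1 hy, ?_⟩
  -- All closure properties are checked on a.e. periods; only positive multiples need homogeneity,
  -- and negative ones follow by taking opposites.
  · have hzero : (0 : EnergyMin.E n) ∈ EnergyMin.maxDensitySet φ :=
      (hmem 0).2 (Eventually.of_forall fun x => by rw [add_zero])
    have hadd : ∀ y z, y ∈ EnergyMin.maxDensitySet φ → z ∈ EnergyMin.maxDensitySet φ →
        y + z ∈ EnergyMin.maxDensitySet φ := fun y z hy hz => by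
      refine (hmem _).2 ?_
      have hq := (measurePreserving_add_right (volume : Measure (EnergyMin.E n))
        y).quasiMeasurePreserving
      filter_upwards [hq.ae ((hmem z).1 hz), (hmem y).1 hy] with x h1 h2
      rw [← add_assoc, h1, h2]
    have hneg : ∀ y, y ∈ EnergyMin.maxDensitySet φ → -y ∈ EnergyMin.maxDensitySet φ :=
        fun y hy => by
      refine (hmem _).2 ?_
      have hq := (measurePreserving_add_right (volume : Measure (EnergyMin.E n))
        (-y)).quasiMeasurePreserving
      filter_upwards [hq.ae ((hmem y).1 hy)] with x h1
      rw [← h1, neg_add_cancel_right]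
    have hpos : ∀ (c : ℝ) y, 0 < c → y ∈ EnergyMin.maxDensitySet φ →
        c • y ∈ EnergyMin.maxDensitySet φ := fun c y hc hy =>
      (hmem _).2 (hhom.ae_translate_smul ((hmem y).1 hy) hc)
    refine ⟨⟨⟨⟨EnergyMin.maxDensitySet φ, fun {y z} => hadd y z⟩, hzero⟩, fun c y hy => ?_⟩, rfl⟩
    rcases lt_trichotomy c 0 with hc | rfl | hc
    · have := hneg _ (hpos (-c) y (neg_pos.2 hc) hy)
      rwa [neg_smul, neg_neg] at this
    · rwa [zero_smul]
    · exact hpos c y hc hy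
  · obtain ⟨ψ, hψ, hψN, hinv⟩ :=
      EnergyMin.exists_invariant_representative hG.locallyIntegrable_fun hmin.ae_mem
    refine ⟨ψ, hψ, hψN, fun c hc x => ?_, fun x y hy => ?_⟩
    · simpa using hinv c 0 hc (by simpa using hhom c hc) x
    · simpa using hinv 1 y one_pos (by simpa using (hmem y).1 hy) x
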